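/- Let $X_1, X_2, \dots$ be independent identically distributed real random variables, let $a_n \in \mathbb{R}$ and $b_n > 0$ ($n \ge 1$) be arbitrary non-random numbers, and put $$Z_n = \frac{X_1 + \dots + X_n}{b_n} - a_n \qquad (n \ge 1).$$ Let $Z$ be a real random variable with a non-extremal (non-degenerate) stable distribution. That is, either $Z$ is normal with positive variance, or there are $0 < \alpha < 2$, $-1 < \beta < 1$, $a \in \mathbb{R}$ and $c > 0$ such that, for all $t \in \mathbb{R}$, $$\mathbb{E}\, e^{itZ} = \exp\big\{ iat - c|t|^\alpha \big(1 + i\beta\, \mathrm{sign}(t)\, \omega(t,\alpha)\big)\big\},$$ where $\omega(t,\alpha) = \tan(\pi\alpha/2)$ if $\alpha \ne 1$ and $\omega(t,1) = \frac{2}{\pi}\log|t|$ (the exponent is read as $0$ at $t = 0$). For random variables $X$ and $Y$ with distributions $\mu$ and $\nu$, let $D(X\|Y) = \int \log\frac{d\mu}{d\nu}\, d\mu$ if $\mu$ is absolutely continuous with respect to $\nu$, and $D(X\|Y) = +\infty$ otherwise. If $D(Z_{n_0}\|Z) < +\infty$ for some $n_0 \ge 1$, then $D(Z_n\|Z) <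 +\infty$ for all $n \ge n_0$. -/

import Mathlib

open MeasureTheory ProbabilityTheory InformationTheory
open scoped ENNReal NNReal

noncomputable section

/-- The function `ω(t, α)` in the canonical form of the stable characteristic functions. -/
def stableOmega (α t : ℝ) : ℝ :=
  if α = 1 then 2 / Real.pi * Real.log |t| else Real.tan (Real.pi * α / 2)

/-- The characteristic function
`f(t) = exp {i a t - c |t| ^ α (1 + i β sign(t) ω(t, α))}`. -/
def stableCharFun (α β a c t : ℝ) : ℂ :=
  Complex.exp (Complex.I * (a * t : ℝ) -
    (c * |t| ^ α : ℝ) * (1 + Complex.I * (β * Real.sign t * stableOmega α t : ℝ)))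

/-- `ν` is the (non-degenerate, non-normal) stable law of index `α` and skewness `β`,
with location `a` and scale constant `c`. -/
structure IsStableLawWith (α β a c : ℝ) (ν : Measure ℝ) : Prop where
  isProbabilityMeasure : IsProbabilityMeasure ν
  alpha_pos : 0 < α
  alpha_lt_two : α < 2
  neg_one_le_beta : -1 ≤ β
  beta_le_one : β ≤ 1
  scale_pos : 0 < c
  charFun_eq : ∀ t : ℝ, charFun ν t = stableCharFun α β a c t

/-- A non-degenerate stable law on the line is non-extremal if it is normal, or if it has index
`0 < α < 2` and skewness `-1 < β < 1`. -/
def IsNonExtremalStable (ν : Measure ℝ) : Prop :=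
  (∃ (m : ℝ) (v : ℝ≥0), v ≠ 0 ∧ ν = gaussianReal m v) ∨
    ∃ α β a c : ℝ, IsStableLawWith α β a c ν ∧ -1 < β ∧ β < 1

/-- The normalized sum `Z_n = (X_1 + ⋯ + X_n) / b_n - a_n`; the summand `X_k` of the mathematical
notation is `X (k - 1)` here, so that `X` runs over all of `ℕ`. -/
def normalizedSum {Ω : Type*} (X : ℕ → Ω → ℝ) (a b : ℕ → ℝ) (n : ℕ) (ω : Ω) : ℝ :=
  (∑ i ∈ Finset.range n, X i ω) / b n - a n

/-- The relative entropy `D(X || Z)` of two real random variables: the Kullback-Leibler divergence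
of the law of `X` from the law of `Z`. For probability measures, `klDiv μ ν` is
`∫ log (dμ/dν) dμ` if `μ ≪ ν` and this integral is finite, and `∞` otherwise. -/
def relEntropy {Ω Ω' : Type*} [MeasurableSpace Ω] [MeasurableSpace Ω']
    (P : Measure Ω) (X : Ω → ℝ) (P' : Measure Ω') (Z : Ω' → ℝ) : ℝ≥0∞ :=
  klDiv (P.map X) (P'.map Z)

end

/-! Let `ν` be the law of `Z`, and let `g` be a weight comparable to the logarithmic decay of the
density of `ν`: `x ^ 2` in the normal case, `log (1 + |x|)` for a stable law with `α < 2`. Write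
`Z_n = s Z_{n₀} + k(R)`, where `R` is the sum of the new summands and is independent of `Z_{n₀}`.
Data processing gives `D(Z_n || s Z + k(R)) ≤ D(Z_{n₀} || Z) < ∞`, with `Z` taken independent of
`R`. It remains to replace the reference law `s Z + k(R)` by `Z`. The former has a bounded density
because `Z` does, and the density of `Z` is at least `exp (-(A + B g))`, so the logarithm of the
density ratio is at most a constant plus `B g`. The change of reference is therefore harmless once
`g(Z_n)` is integrable.

Integrability of `g(Z_n)` also comes from the hypothesis. Some `exp (ε g)` is `ν`-integrable, so
Young's inequality makes `g(Z_{n₀})` integrable. By Fubini the weight of a single summand is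
integrable, hence that of every finite sum. This argument is `relEntropy_normalizedSum_lt_top`, and
it only needs `IsModerateWeight g` and `IsWeightedReference g ν`.

The rest checks these two conditions. The normal case is explicit. For a stable law the
characteristic function is integrable, which bounds the density, and Hölder at `0`, which gives a
small power moment. The polynomial lower bound on the density uses non-extremality: the Lévy measure
charges both half-lines, so `ν` dominates a multiple of the law of a difference of two large jumps,
convolved with a probability measure (`exists_smul_conv_le`). To reach this from the formula for the
characteristic function, one-sided stable laws are built from their Lévy measure and their exponents
are computed by analytic continuation. -/

/-! ### Weights and reference laws. -/

/-- A nonnegative weight function on the line that grows moderately under sums and dilations. -/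
structure IsModerateWeight (g : ℝ → ℝ) : Prop where
  measurable : Measurable g
  nonneg : ∀ x, 0 ≤ g x
  add_le : ∃ C : ℝ, 0 ≤ C ∧ ∀ x y, g (x + y) ≤ C * (1 + g x + g y)
  mul_le : ∀ s : ℝ, ∃ C : ℝ, 0 ≤ C ∧ ∀ x, g (s * x) ≤ C * (1 + g x)

/-- `ν` has a bounded density which is at least `exp (-(A + B * g))` for some constants `A`, `B`,
and `g` has an exponential moment under `ν`. -/
structure IsWeightedReference (g : ℝ → ℝ) (ν : Measure ℝ) : Prop where
  le_volume : ∃ M : ℝ≥0∞, M ≠ ∞ ∧ ν ≤ M • volume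
  volume_le : ∃ A B : ℝ, 0 ≤ A ∧ 0 ≤ B ∧
    volume.withDensity (fun x ↦ ENNReal.ofReal (Real.exp (-(A + B * g x)))) ≤ ν
  exp_moment : ∃ ε : ℝ, 0 < ε ∧ ∫⁻ x, ENNReal.ofReal (Real.exp (ε * g x)) ∂ν ≠ ∞

/-! ### Relative entropy, integrability and change of the reference measure. -/

/-- Young's inequality for the conjugate pair `r log r - r` and `exp y`, with a slack of `1` that
turns the first function into the nonnegative `klFun`. -/
theorem mul_le_klFun_add_exp {r : ℝ} (hr : 0 ≤ r) (y : ℝ) :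
    r * y ≤ klFun r + Real.exp y := by
  rw [klFun_apply]
  rcases hr.eq_or_lt with rfl | hr
  · simp; positivity
  · have h := Real.add_one_le_exp (y - Real.log r)
    rw [Real.exp_sub, Real.exp_log hr, le_div_iff₀ hr] at h
    nlinarith

/-- Only the positive part of the log-density can make the entropy infinite; the remainder costs at
most the total mass of the reference measure. -/
theorem klFun_le_one_add_mul_max_log {r : ℝ} (hr : 0 ≤ r) :
    klFun r ≤ 1 + r * max (Real.log r) 0 := by
  rw [klFun_apply]
  have := mul_le_mul_of_nonneg_left (le_max_left (Real.log r) 0) hr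
  linarith

/-- A function with an exponential moment under `ν` is integrable with respect to every measure
of finite relative entropy from `ν`. -/
theorem lintegral_ne_top_of_klDiv_ne_top {α : Type*} [MeasurableSpace α] {μ ν : Measure α}
    [IsFiniteMeasure μ] [IsFiniteMeasure ν] {g : α → ℝ} (hg : Measurable g)
    (h : klDiv μ ν ≠ ∞) {ε : ℝ} (hε : 0 < ε)
    (hexp : ∫⁻ x, ENNReal.ofReal (Real.exp (ε * g x)) ∂ν ≠ ∞) :
    ∫⁻ x, ENNReal.ofReal (g x) ∂μ ≠ ∞ := by
  have hac : μ ≪ ν := (klDiv_ne_top_iff.1 h).1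
  rw [klDiv_eq_lintegral_klFun_of_ac hac] at h
  have hr := Measure.rnDeriv_lt_top μ ν
  have key : ∫⁻ x, ENNReal.ofReal (ε * g x) ∂μ ≠ ∞ := by
    rw [← lintegral_rnDeriv_mul hac (by fun_prop)]
    refine ne_top_of_le_ne_top (ENNReal.add_ne_top.2 ⟨h, hexp⟩) ?_
    rw [← lintegral_add_right _ (by fun_prop)]
    refine lintegral_mono_ae ?_
    filter_upwards [hr] with x hx
    rw [← ENNReal.ofReal_add (klFun_nonneg ENNReal.toReal_nonneg) (Real.exp_nonneg _)]
    nth_rw 1 [← ENNReal.ofReal_toReal hx.ne]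
    rw [← ENNReal.ofReal_mul ENNReal.toReal_nonneg]
    exact ENNReal.ofReal_le_ofReal (mul_le_klFun_add_exp ENNReal.toReal_nonneg _)
  simp_rw [ENNReal.ofReal_mul hε.le] at key
  rw [lintegral_const_mul _ (by fun_prop)] at key
  exact fun h' ↦ key (by rw [h', ENNReal.mul_top (by simpa using hε)])

/-- If `μ` has finite relative entropy from `ν'`, and `ν'` has a density with respect to `ν` whose
logarithm is at most `h` with `h` integrable with respect to `μ`, then `μ` has finite relative
entropy from `ν`. -/
theorem klDiv_ne_top_of_le_withDensity_exp {α : Type*} [MeasurableSpace α] {μ ν' ν : Measure α}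
    [IsFiniteMeasure μ] [IsFiniteMeasure ν'] [IsFiniteMeasure ν] {h : α → ℝ} (hm : Measurable h)
    (h0 : ∀ x, 0 ≤ h x)
    (hμ : klDiv μ ν' ≠ ∞)
    (hν : ν' ≤ ν.withDensity (fun x ↦ ENNReal.ofReal (Real.exp (h x))))
    (hint : ∫⁻ x, ENNReal.ofReal (h x) ∂μ ≠ ∞) :
    klDiv μ ν ≠ ∞ := by
  obtain ⟨hac', hllr⟩ := klDiv_ne_top_iff.1 hμ
  have hν'ν : ν' ≪ ν :=
    (Measure.absolutelyContinuous_of_le hν).trans (withDensity_absolutelyContinuous _ _)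
  have hac : μ ≪ ν := hac'.trans hν'ν
  rw [klDiv_eq_lintegral_klFun_of_ac hac]
  have hv : ∀ᵐ x ∂ν, ν'.rnDeriv ν x ≤ ENNReal.ofReal (Real.exp (h x)) := by
    refine ae_le_of_forall_setLIntegral_le_of_sigmaFinite (Measure.measurable_rnDeriv _ _) ?_
    intro s hs _
    calc ∫⁻ x in s, ν'.rnDeriv ν x ∂ν = ν' s := Measure.setLIntegral_rnDeriv hν'ν s
      _ ≤ (ν.withDensity (fun x ↦ ENNReal.ofReal (Real.exp (h x)))) s := hν s
      _ = _ := withDensity_apply _ hs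
  have hfin := Measure.rnDeriv_lt_top μ ν
  have hbound : ∫⁻ x, ENNReal.ofReal (klFun (μ.rnDeriv ν x).toReal) ∂ν
      ≤ ν Set.univ
        + ∫⁻ x, ENNReal.ofReal (max (Real.log (μ.rnDeriv ν x).toReal) 0) ∂μ := by
    rw [← lintegral_rnDeriv_mul hac (by fun_prop), ← lintegral_one,
      ← lintegral_add_left measurable_const]
    refine lintegral_mono_ae ?_
    filter_upwards [hfin] with x hx
    nth_rw 2 [← ENNReal.ofReal_toReal hx.ne]
    rw [← ENNReal.ofReal_mul ENNReal.toReal_nonneg, ← ENNReal.ofReal_one,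
      ← ENNReal.ofReal_add zero_le_one (by positivity)]
    exact ENNReal.ofReal_le_ofReal (klFun_le_one_add_mul_max_log ENNReal.toReal_nonneg)
  refine ne_top_of_le_ne_top (ENNReal.add_ne_top.2 ⟨measure_ne_top _ _, ?_⟩) hbound
  have hle : ∫⁻ x, ENNReal.ofReal (max (Real.log (μ.rnDeriv ν x).toReal) 0) ∂μ
      ≤ ∫⁻ x, ‖llr μ ν' x‖ₑ ∂μ + ∫⁻ x, ENNReal.ofReal (h x) ∂μ := by
    rw [← lintegral_add_right _ (by fun_prop)]
    refine lintegral_mono_ae ?_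
    -- Chain rule `dμ/dν = dμ/dν' * dν'/dν`: the logarithm splits into `llr μ ν'` and a term bounded
    -- by `h`.
    have h1 := hac.ae_le (Measure.rnDeriv_mul_rnDeriv (κ := ν) hac')
    filter_upwards [h1, hac.ae_le hv, hac.ae_le hfin,
      Measure.rnDeriv_pos hac, hac'.ae_le (Measure.rnDeriv_lt_top μ ν')] with x hx hvx hfx hpos hu
    rw [← ofReal_norm, ← ENNReal.ofReal_add (norm_nonneg _) (h0 x)]
    refine ENNReal.ofReal_le_ofReal (max_le ?_ (add_nonneg (norm_nonneg _) (h0 x)))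
    rw [← hx] at hpos hfx ⊢
    simp only [Pi.mul_apply] at hpos hfx ⊢
    have hu0 : μ.rnDeriv ν' x ≠ 0 := fun h ↦ by simp [h] at hpos
    have hv0 : ν'.rnDeriv ν x ≠ 0 := fun h ↦ by simp [h] at hpos
    have hvt : ν'.rnDeriv ν x ≠ ∞ := ne_top_of_le_ne_top ENNReal.ofReal_ne_top hvx
    have hvp := ENNReal.toReal_pos hv0 hvt
    rw [ENNReal.toReal_mul, Real.log_mul (ENNReal.toReal_pos hu0 hu.ne).ne' hvp.ne']
    gcongr
    · exact Real.le_norm_self _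
    · rw [Real.log_le_iff_le_exp hvp]
      exact ENNReal.toReal_le_of_le_ofReal (Real.exp_nonneg _) hvx
  exact ne_top_of_le_ne_top (ENNReal.add_ne_top.2 ⟨hllr.2.ne, hint⟩) hle

/-! ### Integrability of weights of sums. -/

section Weights

variable {Ω : Type*} [MeasurableSpace Ω] {P : Measure Ω} [IsProbabilityMeasure P] {g : ℝ → ℝ}

theorem IsModerateWeight.lintegral_add_ne_top (hg : IsModerateWeight g) {X Y : Ω → ℝ}
    (hX : Measurable X) (hXg : ∫⁻ ω, ENNReal.ofReal (g (X ω)) ∂P ≠ ∞)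
    (hYg : ∫⁻ ω, ENNReal.ofReal (g (Y ω)) ∂P ≠ ∞) :
    ∫⁻ ω, ENNReal.ofReal (g (X ω + Y ω)) ∂P ≠ ∞ := by
  obtain ⟨C, hC, h⟩ := hg.add_le
  have hgm := hg.measurable
  have : ∫⁻ ω, ENNReal.ofReal (g (X ω + Y ω)) ∂P ≤ ENNReal.ofReal C *
      (1 + ∫⁻ ω, ENNReal.ofReal (g (X ω)) ∂P + ∫⁻ ω, ENNReal.ofReal (g (Y ω)) ∂P) := by
    calc _ ≤ ∫⁻ ω, ENNReal.ofReal C *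
          (1 + ENNReal.ofReal (g (X ω)) + ENNReal.ofReal (g (Y ω))) ∂P := by
          refine lintegral_mono fun ω ↦ ?_
          rw [← ENNReal.ofReal_one, ← ENNReal.ofReal_add zero_le_one (hg.nonneg _),
            ← ENNReal.ofReal_add (add_nonneg zero_le_one (hg.nonneg _)) (hg.nonneg _),
            ← ENNReal.ofReal_mul hC]
          exact ENNReal.ofReal_le_ofReal (h _ _)
      _ = _ := by
          rw [lintegral_const_mul' _ _ ENNReal.ofReal_ne_top,
            lintegral_add_left (by fun_prop), lintegral_add_left (by fun_prop)]
          simp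
  refine ne_top_of_le_ne_top ?_ this
  finiteness

theorem IsModerateWeight.lintegral_mul_ne_top (hg : IsModerateWeight g) {X : Ω → ℝ} (s : ℝ)
    (hXg : ∫⁻ ω, ENNReal.ofReal (g (X ω)) ∂P ≠ ∞) :
    ∫⁻ ω, ENNReal.ofReal (g (s * X ω)) ∂P ≠ ∞ := by
  obtain ⟨C, hC, h⟩ := hg.mul_le s
  have : ∫⁻ ω, ENNReal.ofReal (g (s * X ω)) ∂P ≤ ENNReal.ofReal C *
      (1 + ∫⁻ ω, ENNReal.ofReal (g (X ω)) ∂P) := by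
    calc _ ≤ ∫⁻ ω, ENNReal.ofReal C * (1 + ENNReal.ofReal (g (X ω))) ∂P := by
          refine lintegral_mono fun ω ↦ ?_
          rw [← ENNReal.ofReal_one, ← ENNReal.ofReal_add zero_le_one (hg.nonneg _),
            ← ENNReal.ofReal_mul hC]
          exact ENNReal.ofReal_le_ofReal (h _)
      _ = _ := by
          rw [lintegral_const_mul' _ _ ENNReal.ofReal_ne_top,
            lintegral_add_left measurable_const]
          simp
  refine ne_top_of_le_ne_top ?_ this
  finiteness

theorem IsModerateWeight.lintegral_sum_ne_top (hg : IsModerateWeight g) {X : ℕ → Ω → ℝ}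
    (hX : ∀ i, Measurable (X i)) (hXg : ∀ i, ∫⁻ ω, ENNReal.ofReal (g (X i ω)) ∂P ≠ ∞) (n : ℕ) :
    ∫⁻ ω, ENNReal.ofReal (g (∑ i ∈ Finset.range n, X i ω)) ∂P ≠ ∞ := by
  induction n with
  | zero => simp
  | succ n ih =>
    simp_rw [Finset.sum_range_succ]
    exact hg.lintegral_add_ne_top (by fun_prop) ih (hXg n)

/-- If a moderate weight of a sum of two independent variables is integrable, then so is the weight
of each summand. -/
theorem IsModerateWeight.lintegral_ne_top_of_indepFun_add (hg : IsModerateWeight g) {X Y : Ω → ℝ}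
    (hX : Measurable X) (hY : Measurable Y) (hXY : IndepFun X Y P)
    (h : ∫⁻ ω, ENNReal.ofReal (g (X ω + Y ω)) ∂P ≠ ∞) :
    ∫⁻ ω, ENNReal.ofReal (g (X ω)) ∂P ≠ ∞ := by
  have hgm := hg.measurable
  have hprod := hXY.map_prod_eq_prod_map_map hX.aemeasurable hY.aemeasurable
  have : IsProbabilityMeasure (P.map X) := Measure.isProbabilityMeasure_map hX.aemeasurable
  have : IsProbabilityMeasure (P.map Y) := Measure.isProbabilityMeasure_map hY.aemeasurable
  have h1 : ∫⁻ y, ∫⁻ x, ENNReal.ofReal (g (x + y)) ∂(P.map X) ∂(P.map Y) ≠ ∞ := by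
    rw [← lintegral_prod_symm' (fun z : ℝ × ℝ ↦ ENNReal.ofReal (g (z.1 + z.2))) (by fun_prop),
      ← hprod, lintegral_map (by fun_prop) (by fun_prop)]
    exact h
  -- By Fubini the shifted weight `g (X + y)` is integrable for some fixed `y`; the shift is then
  -- undone by adding the constant `-y`.
  obtain ⟨y, hy⟩ := (ae_lt_top (by fun_prop) h1).exists
  rw [lintegral_map (by fun_prop) hX] at hy
  have := hg.lintegral_add_ne_top (P := P) (X := fun ω ↦ X ω + y) (Y := fun _ ↦ -y)
    (by fun_prop) hy.ne (by simp)
  simpa using this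

end Weights

/-! ### Propagation of finite entropy to later sums. -/

/-- Joining an independent coordinate and applying a measurable map does not increase the relative
entropy. -/
theorem klDiv_map_prod_le {α β γ : Type*} [MeasurableSpace α] [MeasurableSpace β]
    [MeasurableSpace γ] (μ ν : Measure α) [IsFiniteMeasure μ] [IsFiniteMeasure ν]
    (ρ : Measure β) [IsProbabilityMeasure ρ] {h : α × β → γ} (hh : Measurable h) :
    klDiv ((μ.prod ρ).map h) ((ν.prod ρ).map h) ≤ klDiv μ ν := by
  refine (klDiv_map_le _ _ hh).trans ?_
  rw [← Measure.compProd_const, ← Measure.compProd_const, klDiv_compProd_left]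

/-- A bounded density stays bounded after an affine map and the addition of an independent
variable. -/
theorem map_prod_affine_le_volume {ν ρ : Measure ℝ} [IsFiniteMeasure ν] [IsProbabilityMeasure ρ]
    {M : ℝ≥0∞} (hν : ν ≤ M • volume) {s : ℝ} (hs : s ≠ 0) {k : ℝ → ℝ} (hk : Measurable k) :
    (ν.prod ρ).map (fun z ↦ s * z.1 + k z.2) ≤ (M * ENNReal.ofReal |s⁻¹|) • volume := by
  refine Measure.le_intro fun A hA _ ↦ ?_
  rw [Measure.map_apply (by fun_prop) hA, Measure.prod_apply_symm (by measurability)]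
  have h1 (y : ℝ) : ν ((fun x ↦ (x, y)) ⁻¹' ((fun z : ℝ × ℝ ↦ s * z.1 + k z.2) ⁻¹' A))
      ≤ M * ENNReal.ofReal |s⁻¹| * volume A := by
    refine (hν _).trans ?_
    have : (fun x ↦ (x, y)) ⁻¹' ((fun z : ℝ × ℝ ↦ s * z.1 + k z.2) ⁻¹' A)
        = (fun x ↦ s * x) ⁻¹' ((fun x ↦ x + k y) ⁻¹' A) := rfl
    rw [this, Measure.smul_apply, Real.volume_preimage_mul_left hs, measure_preimage_add_right,
      smul_eq_mul, mul_assoc]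
  calc _ ≤ ∫⁻ _, M * ENNReal.ofReal |s⁻¹| * volume A ∂ρ := lintegral_mono h1
    _ = _ := by simp

/-- Finite relative entropy of one normalized sum from a weighted reference law propagates to the
later ones. -/
theorem relEntropy_normalizedSum_lt_top {Ω Ω' : Type*} [MeasurableSpace Ω] [MeasurableSpace Ω']
    (P : Measure Ω) [IsProbabilityMeasure P] (P' : Measure Ω') [IsProbabilityMeasure P']
    (X : ℕ → Ω → ℝ) (hX : ∀ i, Measurable (X i))
    (hindep : iIndepFun X P) (hident : ∀ i, IdentDistrib (X i) (X 0) P P)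
    (a b : ℕ → ℝ) (hb : ∀ n, 1 ≤ n → 0 < b n)
    (Z : Ω' → ℝ) (hZ : Measurable Z) {g : ℝ → ℝ} (hg : IsModerateWeight g)
    (hgZ : IsWeightedReference g (P'.map Z))
    (n₀ : ℕ) (hn₀ : 1 ≤ n₀)
    (hfin : relEntropy P (normalizedSum X a b n₀) P' Z < ∞) (n : ℕ) (hn : n₀ ≤ n) :
    relEntropy P (normalizedSum X a b n) P' Z < ∞ := by
  have hgm := hg.measurable
  have hSm (m : ℕ) : Measurable (normalizedSum X a b m) := by
    unfold normalizedSum; fun_prop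
  unfold relEntropy at hfin ⊢
  set ν := P'.map Z with hνdef
  have : IsProbabilityMeasure ν := Measure.isProbabilityMeasure_map hZ.aemeasurable
  have hSp (m : ℕ) : IsProbabilityMeasure (P.map (normalizedSum X a b m)) :=
    Measure.isProbabilityMeasure_map (hSm m).aemeasurable
  have hb₀ := hb n₀ hn₀
  have hbn := hb n (hn₀.trans hn)
  obtain ⟨ε, hε, hexp⟩ := hgZ.exp_moment
  have hg₀ : ∫⁻ ω, ENNReal.ofReal (g (normalizedSum X a b n₀ ω)) ∂P ≠ ∞ := by
    have := lintegral_ne_top_of_klDiv_ne_top hgm hfin.ne hε hexp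
    rwa [lintegral_map (by fun_prop) (hSm n₀)] at this
  have hsum₀ : ∫⁻ ω, ENNReal.ofReal (g (∑ i ∈ Finset.range n₀, X i ω)) ∂P ≠ ∞ := by
    have := hg.lintegral_mul_ne_top (b n₀) (hg.lintegral_add_ne_top (Y := fun _ ↦ a n₀) (hSm n₀)
      hg₀ (by simp))
    convert this using 5 with ω
    rw [normalizedSum]; field_simp; ring
  have hgX0 : ∫⁻ ω, ENNReal.ofReal (g (X 0 ω)) ∂P ≠ ∞ := by
    -- The sum up to `n₀` is split as `X 0` plus an independent remainder.
    have hind := (hindep.indepFun_finsetSum_of_notMem hX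
      (s := (Finset.range n₀).erase 0) (i := 0) (by simp)).symm
    refine hg.lintegral_ne_top_of_indepFun_add (hX 0) ?_ hind ?_
    · convert Finset.measurable_sum ((Finset.range n₀).erase 0) fun i _ ↦ hX i using 1
      ext ω
      simp
    · convert hsum₀ using 5 with ω
      rw [Finset.sum_apply, Finset.add_sum_erase _ (fun i ↦ X i ω) (by simp; omega)]
  have hgX (i : ℕ) : ∫⁻ ω, ENNReal.ofReal (g (X i ω)) ∂P ≠ ∞ := by
    have h := (hident i).comp (u := fun x ↦ ENNReal.ofReal (g x)) (by fun_prop)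
    rw [show ∫⁻ ω, ENNReal.ofReal (g (X i ω)) ∂P = ∫⁻ ω, ENNReal.ofReal (g (X 0 ω)) ∂P from
      h.lintegral_eq]
    exact hgX0
  have hgn : ∫⁻ x, ENNReal.ofReal (g x) ∂(P.map (normalizedSum X a b n)) ≠ ∞ := by
    rw [lintegral_map (by fun_prop) (hSm n)]
    have := hg.lintegral_add_ne_top (P := P) (Y := fun _ ↦ -a n) (by fun_prop)
      (hg.lintegral_mul_ne_top (b n)⁻¹ (hg.lintegral_sum_ne_top hX hgX n)) (by simp)
    convert this using 5 with ω
    rw [normalizedSum]; ring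
  set R : Ω → ℝ := fun ω ↦ ∑ i ∈ Finset.Ico n₀ n, X i ω with hR
  have hRm : Measurable R := by fun_prop
  set ρ := P.map R
  have : IsProbabilityMeasure ρ := Measure.isProbabilityMeasure_map hRm.aemeasurable
  set s := b n₀ / b n
  have hs : s ≠ 0 := (div_pos hb₀ hbn).ne'
  -- Chosen so that `Z_n = s * Z_{n₀} + k R`; the shift by `a n₀` is undone inside `k`.
  set k : ℝ → ℝ := fun y ↦ y / b n + s * a n₀ - a n with hk
  have hkm : Measurable k := by fun_prop
  have hind : IndepFun (normalizedSum X a b n₀) R P := by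
    have hd : Disjoint (Finset.range n₀) (Finset.Ico n₀ n) := by
      rw [Finset.disjoint_left]; intro i; simp; omega
    have h := hindep.indepFun_finset _ _ hd hX
    have h' := h.comp (φ := fun x : Finset.range n₀ → ℝ ↦ (∑ i, x i) / b n₀ - a n₀)
      (ψ := fun x : Finset.Ico n₀ n → ℝ ↦ ∑ i, x i) (by fun_prop) (by fun_prop)
    convert h' using 1
    · ext ω
      simp only [normalizedSum, Function.comp]
      rw [← Finset.sum_coe_sort (Finset.range n₀)]
    · ext ω
      simp only [hR, Function.comp]
      rw [← Finset.sum_coe_sort (Finset.Ico n₀ n)]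
  have hlaw : P.map (normalizedSum X a b n) =
      ((P.map (normalizedSum X a b n₀)).prod ρ).map (fun z ↦ s * z.1 + k z.2) := by
    rw [← hind.map_prod_eq_prod_map_map (hSm n₀).aemeasurable hRm.aemeasurable,
      Measure.map_map (by fun_prop) ((hSm n₀).prodMk hRm)]
    congr 1
    ext ω
    simp only [normalizedSum, hk, hR, Function.comp, s]
    rw [← Finset.sum_range_add_sum_Ico _ hn]
    field_simp
    ring
  set ν' := (ν.prod ρ).map (fun z : ℝ × ℝ ↦ s * z.1 + k z.2)
  have : IsProbabilityMeasure ν' := Measure.isProbabilityMeasure_map (by fun_prop)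
  have hkl : klDiv (P.map (normalizedSum X a b n)) ν' ≠ ∞ := by
    rw [hlaw]
    exact ne_top_of_le_ne_top hfin.ne (klDiv_map_prod_le _ _ ρ (by fun_prop))
  obtain ⟨M, hM, hνM⟩ := hgZ.le_volume
  obtain ⟨A, B, hA, hB, hAB⟩ := hgZ.volume_le
  set M' := M * ENNReal.ofReal |s⁻¹|
  have hM' : M' ≠ ∞ := by finiteness
  have hν' : ν' ≤ M' • volume := map_prod_affine_le_volume hνM hs hkm
  -- The maximum with `0` keeps the bound `L + (A + B * g)` on the log-density nonnegative.
  set L := max (Real.log M'.toReal) 0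
  have hL : M' ≤ ENNReal.ofReal (Real.exp L) := by
    rw [← ENNReal.ofReal_toReal hM']
    refine ENNReal.ofReal_le_ofReal ?_
    rcases ENNReal.toReal_nonneg (a := M').eq_or_lt with h | h
    · rw [← h]; positivity
    · exact (Real.log_le_iff_le_exp h).1 (le_max_left _ _)
  have hL0 : 0 ≤ L := le_max_right _ _
  refine lt_top_iff_ne_top.2
    (klDiv_ne_top_of_le_withDensity_exp (h := fun x ↦ L + (A + B * g x)) (by fun_prop) ?_ hkl ?_ ?_)
  · intro x
    have := hg.nonneg x
    positivity
  · calc ν' ≤ M' • volume := hν'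
      _ ≤ ENNReal.ofReal (Real.exp L) • volume := by gcongr
      -- Lebesgue measure is rewritten as `exp (-(A + B g)) dx` reweighted by the reciprocal, so
      -- that the lower bound on `ν` can be inserted.
      _ = (volume.withDensity (fun x ↦ ENNReal.ofReal (Real.exp (-(A + B * g x))))).withDensity
          (fun x ↦ ENNReal.ofReal (Real.exp (L + (A + B * g x)))) := by
          rw [← withDensity_mul _ (by fun_prop) (by fun_prop), ← withDensity_const]
          congr 1
          ext x
          rw [Pi.mul_apply, ← ENNReal.ofReal_mul (Real.exp_nonneg _), ← Real.exp_add]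
          congr 2
          ring
      _ ≤ _ := by
          refine Measure.le_intro fun t ht _ ↦ ?_
          rw [withDensity_apply _ ht, withDensity_apply _ ht]
          exact lintegral_mono' (Measure.restrict_mono le_rfl hAB) le_rfl
  · have : ∫⁻ x, ENNReal.ofReal (L + (A + B * g x)) ∂(P.map (normalizedSum X a b n)) =
        ENNReal.ofReal L + (ENNReal.ofReal A + ENNReal.ofReal B *
          ∫⁻ x, ENNReal.ofReal (g x) ∂(P.map (normalizedSum X a b n))) := by
      rw [← lintegral_const_mul _ (by fun_prop)]
      simp_rw [← ENNReal.ofReal_mul hB]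
      have h1 (x : ℝ) : ENNReal.ofReal (L + (A + B * g x)) =
          ENNReal.ofReal L + (ENNReal.ofReal A + ENNReal.ofReal (B * g x)) := by
        have := hg.nonneg x
        rw [← ENNReal.ofReal_add hA (by positivity), ← ENNReal.ofReal_add hL0 (by positivity)]
      simp_rw [h1]
      rw [lintegral_add_left measurable_const, lintegral_add_left measurable_const]
      simp
    rw [this]
    finiteness

/-! ### Density bounds and tails from the characteristic function. -/

/-- Gaussian smoothing of a probability measure in terms of its characteristic function. -/
theorem integral_exp_neg_sq_eq_integral_charFun {ν : Measure ℝ} [IsProbabilityMeasure ν]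
    (v : ℝ≥0) (x : ℝ) :
    ((∫ y, Real.exp (-(v * (y - x) ^ 2 / 2)) ∂ν : ℝ) : ℂ) =
      ∫ t, charFun ν t * Complex.exp (-(t * x) * Complex.I) ∂(gaussianReal 0 v) := by
  have h1 (t : ℝ) : charFun ν t * Complex.exp (-(t * x) * Complex.I) =
      ∫ y : ℝ, Complex.exp (t * (y - x) * Complex.I) ∂ν := by
    rw [charFun_apply_real, ← integral_mul_const]
    congr 1
    ext y
    rw [← Complex.exp_add]
    congr 1
    ring
  simp_rw [h1]
  rw [integral_integral_swap]
  · rw [← integral_complex_ofReal]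
    congr 1
    ext y
    have h2 := charFun_gaussianReal (μ := 0) (v := v) (y - x)
    rw [charFun_apply_real] at h2
    push_cast at h2 ⊢
    rw [show -((v : ℂ) * (y - x) ^ 2 / 2) = (y - x) * 0 * Complex.I - v * (y - x) ^ 2 / 2 by ring,
      ← h2]
    congr 1
    ext t
    congr 1
    ring
  · refine Integrable.of_bound (C := 1) (Measurable.aestronglyMeasurable ?_) (ae_of_all _ ?_)
    · unfold Function.uncurry; fun_prop
    · rintro ⟨t, y⟩
      have := Complex.norm_exp_ofReal_mul_I (t * (y - x))
      push_cast at this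
      simp [Function.uncurry, this]

/-- Test `ν` against a Gaussian bump of width `h` centred at `x`. The bump is at least `exp (-1/2)`
on the ball. On the Fourier side it becomes the normal density of variance `h ^ (-2)`, which is at
most `h / √(2π) ≤ h`. -/
theorem measure_closedBall_le_of_integrable_charFun {ν : Measure ℝ} [IsProbabilityMeasure ν]
    (hν : Integrable (charFun ν)) (x : ℝ) {h : ℝ} (hh : 0 < h) :
    ν (Metric.closedBall x h) ≤
      ENNReal.ofReal (Real.exp (1 / 2) * ∫ t, ‖charFun ν t‖) * volume (Metric.closedBall x h) := by
  set I := ∫ t, ‖charFun ν t‖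
  have hI : 0 ≤ I := integral_nonneg fun _ ↦ norm_nonneg _
  set v : ℝ≥0 := Real.toNNReal (h ^ 2)⁻¹
  have hv0 : v ≠ 0 := (Real.toNNReal_pos.2 (by positivity)).ne'
  have hvh : (v : ℝ) = (h ^ 2)⁻¹ := Real.coe_toNNReal _ (by positivity)
  have hint : Integrable (fun y ↦ Real.exp (-(v * (y - x) ^ 2 / 2))) ν := by
    refine Integrable.of_bound (C := 1) (by fun_prop) (ae_of_all _ fun y ↦ ?_)
    rw [Real.norm_eq_abs, Real.abs_exp, Real.exp_le_one_iff]
    have : 0 ≤ (v : ℝ) * (y - x) ^ 2 / 2 := by positivity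
    linarith
  have hlow : Real.exp (-(1 / 2)) * ν.real (Metric.closedBall x h) ≤
      ∫ y, Real.exp (-(v * (y - x) ^ 2 / 2)) ∂ν := by
    rw [mul_comm, ← smul_eq_mul, ← setIntegral_const]
    refine (setIntegral_mono_on (integrable_const _).integrableOn hint.integrableOn
      Metric.isClosed_closedBall.measurableSet fun y hy ↦ ?_).trans
      (setIntegral_le_integral hint (ae_of_all _ fun y ↦ Real.exp_nonneg _))
    rw [Real.exp_le_exp, neg_le_neg_iff, hvh]
    rw [Metric.mem_closedBall, Real.dist_eq] at hy
    have : (y - x) ^ 2 ≤ h ^ 2 := by rw [← sq_abs]; gcongr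
    have : (h ^ 2)⁻¹ * (y - x) ^ 2 ≤ 1 := by
      rw [inv_mul_le_iff₀ (by positivity)]; linarith
    linarith
  have hup : ∫ y, Real.exp (-(v * (y - x) ^ 2 / 2)) ∂ν ≤ h * I := by
    have h1 := integral_exp_neg_sq_eq_integral_charFun (ν := ν) v x
    have h0 : 0 ≤ ∫ y, Real.exp (-(v * (y - x) ^ 2 / 2)) ∂ν :=
      integral_nonneg fun _ ↦ Real.exp_nonneg _
    have h2 := congrArg norm h1
    rw [Complex.norm_real, Real.norm_of_nonneg h0] at h2
    rw [h2, integral_gaussianReal_eq_integral_smul hv0]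
    calc _ ≤ ∫ t, ‖gaussianPDFReal 0 v t • (charFun ν t * Complex.exp (-(t * x) * Complex.I))‖ :=
          norm_integral_le_integral_norm _
      _ ≤ ∫ t, h * ‖charFun ν t‖ := by
          refine integral_mono_of_nonneg (ae_of_all _ fun _ ↦ norm_nonneg _)
            (hν.norm.const_mul h) (ae_of_all _ fun t ↦ ?_)
          have he := Complex.norm_exp_ofReal_mul_I (-(t * x))
          push_cast at he
          simp only [norm_smul, norm_mul, he, mul_one]
          gcongr
          rw [Real.norm_of_nonneg (gaussianPDFReal_nonneg _ _ _), gaussianPDFReal_def]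
          have e1 : Real.exp (-(t - 0) ^ 2 / (2 * v)) ≤ 1 := by
            rw [Real.exp_le_one_iff, neg_div]
            have : 0 ≤ (t - 0) ^ 2 / (2 * (v : ℝ)) := by positivity
            linarith
          have e2 : (√(2 * Real.pi * v))⁻¹ ≤ h := by
            rw [inv_le_comm₀ (by positivity) hh]
            refine Real.le_sqrt_of_sq_le ?_
            rw [hvh, inv_pow]
            have : (0 : ℝ) < (h ^ 2)⁻¹ := by positivity
            nlinarith [Real.pi_gt_three]
          calc _ ≤ h * 1 := mul_le_mul e2 e1 (Real.exp_nonneg _) hh.le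
            _ = h := mul_one h
      _ = h * I := integral_const_mul _ _
  rw [Real.volume_closedBall, ← ENNReal.ofReal_mul (by positivity),
    ← ENNReal.ofReal_toReal (measure_ne_top ν _)]
  refine ENNReal.ofReal_le_ofReal ?_
  have h3 := hlow.trans hup
  rw [Real.exp_neg, inv_mul_le_iff₀ (by positivity)] at h3
  have : 0 ≤ Real.exp (1 / 2) * I * h := by positivity
  calc _ ≤ _ := h3
    _ ≤ _ := by linarith

/-- A probability measure with integrable characteristic function has a bounded density. -/
theorem le_smul_volume_of_integrable_charFun {ν : Measure ℝ} [IsProbabilityMeasure ν]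
    (hν : Integrable (charFun ν)) :
    ν ≤ ENNReal.ofReal (Real.exp (1 / 2) * ∫ t, ‖charFun ν t‖) • volume := by
  set M := Real.exp (1 / 2) * ∫ t, ‖charFun ν t‖
  have : IsLocallyFiniteMeasure (ENNReal.ofReal M • (volume : Measure ℝ)) :=
    inferInstanceAs (IsLocallyFiniteMeasure (M.toNNReal • (volume : Measure ℝ)))
  -- The Besicovitch differentiation theorem passes from small balls to arbitrary sets.
  refine fun s ↦ (Besicovitch.vitaliFamily ν).measure_le_of_frequently_le _ .rfl s fun x _ ↦ ?_
  refine (Besicovitch.tendsto_filterAt ν x).frequently (Filter.Eventually.frequently ?_)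
  filter_upwards [self_mem_nhdsWithin] with h hh
  exact measure_closedBall_le_of_integrable_charFun hν x hh

/-- A Hölder bound at the origin for the characteristic function bounds the tails. -/
theorem measureReal_lt_abs_le_of_charFun {ν : Measure ℝ} [IsProbabilityMeasure ν] {C η : ℝ}
    (hC : 0 ≤ C) (hη : 0 < η) (h : ∀ t, |t| ≤ 1 → ‖1 - charFun ν t‖ ≤ C * |t| ^ η) {r : ℝ}
    (hr : 2 ≤ r) : ν.real {x | r < |x|} ≤ 2 * C * 2 ^ η * r ^ (-η) := by
  have hr0 : 0 < r := by linarith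
  have hr1 : 2 * r⁻¹ ≤ 1 := by rw [← div_eq_mul_inv, div_le_one hr0]; exact hr
  refine (measureReal_abs_gt_le_integral_charFun hr0).trans ?_
  have : ‖∫ t in (-2 * r⁻¹)..(2 * r⁻¹), 1 - charFun ν t‖ ≤
      (C * (2 * r⁻¹) ^ η) * |2 * r⁻¹ - -2 * r⁻¹| := by
    refine intervalIntegral.norm_integral_le_of_norm_le_const fun t ht ↦ ?_
    have hp : 0 < 2 * r⁻¹ := by positivity
    rw [Set.uIoc_of_le (by linarith), Set.mem_Ioc] at ht
    have ht' : |t| ≤ 2 * r⁻¹ := abs_le.2 ⟨by linarith, ht.2⟩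
    refine (h t (ht'.trans hr1)).trans ?_
    gcongr
  calc _ ≤ 2⁻¹ * r * ((C * (2 * r⁻¹) ^ η) * |2 * r⁻¹ - -2 * r⁻¹|) := by gcongr
    _ = _ := by
      rw [show 2 * r⁻¹ - -2 * r⁻¹ = 4 * r⁻¹ by ring, abs_of_pos (by positivity),
        Real.mul_rpow (by norm_num) (by positivity), Real.inv_rpow hr0.le, Real.rpow_neg hr0.le]
      field_simp
      ring

/-- The tails are `O(r ^ (-η))`, so the moment of order `η / 2` is finite. The exponential of `ε log
(1 + |x|)` is `(1 + |x|) ^ ε`, which subadditivity bounds by `1 + |x| ^ ε`, because `ε = η / 2 ≤ 1`.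
-/
theorem exists_lintegral_exp_log_ne_top_of_charFun {ν : Measure ℝ} [IsProbabilityMeasure ν]
    {C η : ℝ} (hC : 0 ≤ C) (hη : 0 < η) (hη1 : η ≤ 1)
    (h : ∀ t, |t| ≤ 1 → ‖1 - charFun ν t‖ ≤ C * |t| ^ η) :
    ∃ ε : ℝ, 0 < ε ∧ ∫⁻ x, ENNReal.ofReal (Real.exp (ε * Real.log (1 + |x|))) ∂ν ≠ ∞ := by
  refine ⟨η / 2, by positivity, ?_⟩
  set p := η / 2 with hp
  have hp0 : 0 < p := by positivity
  have hmom : ∫⁻ x, ENNReal.ofReal (|x| ^ p) ∂ν ≠ ∞ := by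
    rw [lintegral_rpow_eq_lintegral_meas_lt_mul ν (ae_of_all _ fun _ ↦ abs_nonneg _)
      (by fun_prop) hp0]
    refine ENNReal.mul_ne_top ENNReal.ofReal_ne_top ?_
    -- The tail bound is available only from `2` on; below that the trivial bound `1` suffices.
    rw [← Set.Ioc_union_Ioi_eq_Ioi (zero_le_two (α := ℝ)),
      lintegral_union measurableSet_Ioi (Set.Ioc_disjoint_Ioi le_rfl)]
    refine ENNReal.add_ne_top.2 ⟨?_, ?_⟩
    · have hi : IntegrableOn (fun t : ℝ ↦ t ^ (p - 1)) (Set.Ioc 0 2) := by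
        rw [← intervalIntegrable_iff_integrableOn_Ioc_of_le zero_le_two]
        exact intervalIntegral.intervalIntegrable_rpow' (by linarith)
      refine ne_top_of_le_ne_top hi.lintegral_lt_top.ne (lintegral_mono fun t ↦ ?_)
      exact mul_le_of_le_one_left' prob_le_one
    · have hi : IntegrableOn (fun t : ℝ ↦ 2 * C * 2 ^ η * t ^ (-p - 1)) (Set.Ioi 2) :=
        (integrableOn_Ioi_rpow_of_lt (by linarith) zero_lt_two).const_mul _
      refine ne_top_of_le_ne_top hi.lintegral_lt_top.ne
        (setLIntegral_mono' measurableSet_Ioi fun t ht ↦ ?_)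
      have ht2 : 2 < t := ht
      have ht0 : 0 < t := by linarith
      rw [← ENNReal.ofReal_toReal (measure_ne_top ν _), ← ENNReal.ofReal_mul ENNReal.toReal_nonneg]
      refine ENNReal.ofReal_le_ofReal ?_
      calc _ ≤ 2 * C * 2 ^ η * t ^ (-η) * t ^ (p - 1) := by
            gcongr
            exact measureReal_lt_abs_le_of_charFun hC hη h ht2.le
        _ = _ := by
            rw [mul_assoc, ← Real.rpow_add ht0]
            congr 2
            rw [hp]; ring
  have hle : ∫⁻ x, ENNReal.ofReal (Real.exp (p * Real.log (1 + |x|))) ∂ν ≤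
      1 + ∫⁻ x, ENNReal.ofReal (|x| ^ p) ∂ν := by
    calc _ ≤ ∫⁻ x, 1 + ENNReal.ofReal (|x| ^ p) ∂ν := by
          refine lintegral_mono fun x ↦ ?_
          have hx : 0 < 1 + |x| := by positivity
          rw [← ENNReal.ofReal_one, ← ENNReal.ofReal_add zero_le_one (by positivity),
            mul_comm, ← Real.rpow_def_of_pos hx]
          refine ENNReal.ofReal_le_ofReal ?_
          have := Real.rpow_add_le_add_rpow zero_le_one (abs_nonneg x) hp0.le
            (by linarith : p ≤ 1)
          simpa using this
      _ = _ := by rw [lintegral_add_left measurable_const]; simp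
  exact ne_top_of_le_ne_top (ENNReal.add_ne_top.2 ⟨ENNReal.one_ne_top, hmom⟩) hle

/-! ### The two weights, and the normal reference law. -/

theorem isModerateWeight_log_one_add_abs : IsModerateWeight fun x ↦ Real.log (1 + |x|) where
  measurable := by fun_prop
  nonneg x := Real.log_nonneg (by linarith [abs_nonneg x])
  add_le := by
    refine ⟨1, zero_le_one, fun x y ↦ ?_⟩
    have h : Real.log (1 + |x + y|) ≤ Real.log ((1 + |x|) * (1 + |y|)) := by
      refine Real.log_le_log (by positivity) ?_
      nlinarith [abs_add_le x y, mul_nonneg (abs_nonneg x) (abs_nonneg y)]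
    rw [Real.log_mul (by positivity) (by positivity)] at h
    linarith
  mul_le s := by
    have h0 : 0 ≤ Real.log (1 + |s|) := Real.log_nonneg (by linarith [abs_nonneg s])
    refine ⟨1 + Real.log (1 + |s|), by positivity, fun x ↦ ?_⟩
    have h : Real.log (1 + |s * x|) ≤ Real.log ((1 + |s|) * (1 + |x|)) := by
      refine Real.log_le_log (by positivity) ?_
      rw [abs_mul]
      nlinarith [abs_nonneg s, abs_nonneg x]
    rw [Real.log_mul (by positivity) (by positivity)] at h
    have h1 : 0 ≤ Real.log (1 + |x|) := Real.log_nonneg (by linarith [abs_nonneg x])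
    nlinarith

theorem isModerateWeight_sq : IsModerateWeight fun x ↦ x ^ 2 where
  measurable := by fun_prop
  nonneg x := sq_nonneg x
  add_le := ⟨2, zero_le_two, fun x y ↦ by nlinarith [sq_nonneg (x - y)]⟩
  mul_le s := ⟨s ^ 2, sq_nonneg s, fun x ↦ by nlinarith [sq_nonneg s, sq_nonneg x]⟩

theorem isWeightedReference_gaussianReal (m : ℝ) {v : ℝ≥0} (hv : v ≠ 0) :
    IsWeightedReference (fun x ↦ x ^ 2) (gaussianReal m v) where
  le_volume := by
    refine ⟨ENNReal.ofReal (√(2 * Real.pi * v))⁻¹, ENNReal.ofReal_ne_top, ?_⟩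
    rw [gaussianReal_of_var_ne_zero _ hv, ← withDensity_const]
    refine withDensity_mono (ae_of_all _ fun x ↦ ENNReal.ofReal_le_ofReal ?_)
    rw [gaussianPDFReal_def]
    refine mul_le_of_le_one_right (by positivity) ?_
    rw [Real.exp_le_one_iff, neg_div]
    have : 0 ≤ (x - m) ^ 2 / (2 * (v : ℝ)) := by positivity
    linarith
  volume_le := by
    have hv' : (0 : ℝ) < v := by positivity
    -- The constants come from `(x - m) ^ 2 ≤ 2 * m ^ 2 + 2 * x ^ 2`.
    refine ⟨max (Real.log √(2 * Real.pi * v)) 0 + m ^ 2 / v, 1 / v, by positivity, by positivity, ?_⟩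
    rw [gaussianReal_of_var_ne_zero _ hv]
    refine withDensity_mono (ae_of_all _ fun x ↦ ENNReal.ofReal_le_ofReal ?_)
    rw [gaussianPDFReal_def]
    have hs : 0 < √(2 * Real.pi * v) := by positivity
    calc _ ≤ Real.exp (-Real.log √(2 * Real.pi * v) + -(x - m) ^ 2 / (2 * v)) := by
          rw [Real.exp_le_exp]
          have h1 := le_max_left (Real.log √(2 * Real.pi * v)) 0
          have h2 : (x - m) ^ 2 / (2 * v) ≤ m ^ 2 / v + 1 / v * x ^ 2 := by
            rw [div_le_iff₀ (by positivity)]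
            field_simp
            nlinarith [sq_nonneg (x + m)]
          rw [neg_div]
          linarith
      _ = _ := by
          rw [Real.exp_add, Real.exp_neg, Real.exp_log hs]
  exp_moment := by
    have hv' : (0 : ℝ) < v := by positivity
    -- With this `ε`, the total exponent is at most `m ^ 2 / (2 v) - x ^ 2 / (8 v)`, the gap being
    -- the square `(2 m - x) ^ 2 / (4 v)`.
    refine ⟨1 / (8 * v), by positivity, ?_⟩
    rw [gaussianReal_of_var_ne_zero _ hv,
      lintegral_withDensity_eq_lintegral_mul _ (by fun_prop) (by fun_prop)]
    have hi : Integrable (fun x : ℝ ↦ ((√(2 * Real.pi * v))⁻¹ * Real.exp (m ^ 2 / (2 * v))) *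
        Real.exp (-(1 / (8 * v)) * x ^ 2)) :=
      (integrable_exp_neg_mul_sq (by positivity)).const_mul _
    refine ne_top_of_le_ne_top hi.lintegral_lt_top.ne (lintegral_mono fun x ↦ ?_)
    rw [Pi.mul_apply, gaussianPDF, ← ENNReal.ofReal_mul (gaussianPDFReal_nonneg _ _ _),
      gaussianPDFReal_def]
    refine ENNReal.ofReal_le_ofReal ?_
    simp only [mul_assoc]
    rw [← Real.exp_add, ← Real.exp_add]
    refine mul_le_mul_of_nonneg_left (Real.exp_le_exp.2 ?_) (by positivity)
    rw [← sub_nonneg]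
    have : m ^ 2 / (2 * v) + -(1 / (8 * v)) * x ^ 2 - (-(x - m) ^ 2 / (2 * v) + 1 / (8 * v) * x ^ 2)
        = (2 * m - x) ^ 2 / (4 * v) := by
      field_simp; ring
    rw [this]
    positivity

/-! ### The one-sided Lévy exponent and its closed form. -/

/-- The Laplace exponent of the one-sided Lévy measure `x ^ (-1 - α) dx` on `(0, ∞)`, compensated
by `x * exp (-x)`. -/
noncomputable def levyExponent (α : ℝ) (z : ℂ) : ℂ :=
  ∫ x in Set.Ioi (0 : ℝ),
    (Complex.exp (-(z * x)) - 1 + z * (x * Real.exp (-x) : ℝ)) * (x ^ (-1 - α) : ℝ)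

theorem norm_exp_neg_sub_exp_neg_le {w w' : ℂ} (hw : 0 ≤ w.re) (hw' : 0 ≤ w'.re) :
    ‖Complex.exp (-w) - Complex.exp (-w')‖ ≤ ‖w - w'‖ := by
  have h := (convex_halfSpace_re_ge 0).norm_image_sub_le_of_norm_hasDerivWithin_le
    (f := fun z ↦ Complex.exp (-z)) (f' := fun z ↦ -Complex.exp (-z)) (C := 1)
    (fun z _ ↦ ?_) (fun z hz ↦ ?_) hw' hw
  · simpa using h
  · simpa using ((hasDerivAt_neg z).cexp).hasDerivWithinAt
  · rw [norm_neg, Complex.norm_exp, Complex.neg_re, Real.exp_le_one_iff]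
    simpa using hz

/-- Mean value inequality on the half-disc `0 ≤ Re z`, `‖z‖ ≤ ‖w‖`, where the derivative has norm at
most `‖w‖` by the previous estimate. -/
theorem norm_exp_neg_sub_one_add_le {w : ℂ} (hw : 0 ≤ w.re) :
    ‖Complex.exp (-w) - 1 + w‖ ≤ ‖w‖ ^ 2 := by
  have hconv : Convex ℝ ({z : ℂ | 0 ≤ z.re} ∩ Metric.closedBall 0 ‖w‖) :=
    (convex_halfSpace_re_ge 0).inter (convex_closedBall 0 _)
  have h := hconv.norm_image_sub_le_of_norm_hasDerivWithin_le
    (f := fun z ↦ Complex.exp (-z) - 1 + z) (f' := fun z ↦ -(Complex.exp (-z) - 1)) (C := ‖w‖)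
    (x := 0) (y := w) (fun z _ ↦ ?_) (fun z hz ↦ ?_) (by simp) (by simp [hw])
  · simpa [sq] using h
  · have := (((hasDerivAt_neg z).cexp).sub_const 1).add (hasDerivAt_id z)
    refine (this.congr_deriv ?_).hasDerivWithinAt
    ring
  · rw [norm_neg]
    have := norm_exp_neg_sub_exp_neg_le (w := z) (w' := 0) hz.1 le_rfl
    simp only [neg_zero, Complex.exp_zero, sub_zero] at this
    exact this.trans (by simpa using hz.2)

/-- The common majorant of the exponent and its two derivatives: `x ^ 2` handles the origin because
`α < 2`, and `1` handles infinity because `0 < α`. -/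
theorem integrableOn_min_one_sq_mul_rpow {α : ℝ} (h0 : 0 < α) (h2 : α < 2) :
    IntegrableOn (fun x : ℝ ↦ min 1 (x ^ 2) * x ^ (-1 - α)) (Set.Ioi 0) := by
  rw [← Set.Ioc_union_Ioi_eq_Ioi zero_le_one, integrableOn_union]
  constructor
  · have hi : IntegrableOn (fun t : ℝ ↦ t ^ (1 - α)) (Set.Ioc 0 1) := by
      rw [← intervalIntegrable_iff_integrableOn_Ioc_of_le zero_le_one]
      exact intervalIntegral.intervalIntegrable_rpow' (by linarith)
    refine hi.congr_fun (fun x hx ↦ ?_) measurableSet_Ioc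
    have : x ^ 2 ≤ 1 := by nlinarith [hx.1, hx.2]
    simp only
    rw [min_eq_right this, ← Real.rpow_natCast, ← Real.rpow_add hx.1]
    congr 1
    push_cast; ring
  · refine (integrableOn_Ioi_rpow_of_lt (a := -1 - α) (by linarith) zero_lt_one).congr_fun
      (fun x hx ↦ ?_) measurableSet_Ioi
    have hx : 1 < x := hx
    simp only
    rw [min_eq_left (by nlinarith), one_mul]

theorem le_mul_min_one_sq {u a b x : ℝ} (ha : 0 ≤ a) (hb : 0 ≤ b) (h1 : u ≤ a * x ^ 2)
    (h2 : u ≤ b) : u ≤ (a + b) * min 1 (x ^ 2) := by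
  rcases min_cases 1 (x ^ 2) with ⟨h, _⟩ | ⟨h, _⟩
  · rw [h]; linarith
  · rw [h]; nlinarith [sq_nonneg x]

theorem mul_exp_neg_le_one (x : ℝ) : x * Real.exp (-x) ≤ 1 := by
  rw [Real.exp_neg, ← div_eq_mul_inv, div_le_one (Real.exp_pos x)]
  linarith [Real.add_one_le_exp x]

theorem one_sub_exp_neg_le (x : ℝ) : 1 - Real.exp (-x) ≤ x := by
  linarith [Real.add_one_le_exp (-x)]

theorem norm_levy_integrand_le {z : ℂ} (hz : 0 ≤ z.re) {R : ℝ} (hR : ‖z‖ ≤ R) {x : ℝ}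
    (hx : 0 < x) :
    ‖Complex.exp (-(z * x)) - 1 + z * (x * Real.exp (-x) : ℝ)‖ ≤
      (R ^ 2 + R + (2 + R)) * min 1 (x ^ 2) := by
  have hR0 : 0 ≤ R := (norm_nonneg z).trans hR
  have hre : 0 ≤ (z * x).re := by simp; positivity
  have hxe : 0 ≤ x * Real.exp (-x) := by positivity
  refine le_mul_min_one_sq (by positivity) (by positivity) ?_ ?_
  -- Comparing the compensator with `z * x` exposes the second-order cancellation at the origin.
  · have e : Complex.exp (-(z * x)) - 1 + z * (x * Real.exp (-x) : ℝ) =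
        (Complex.exp (-(z * x)) - 1 + z * x) - z * (x * (1 - Real.exp (-x)) : ℝ) := by
      push_cast; ring
    rw [e]
    refine (norm_sub_le _ _).trans ?_
    have h1 := norm_exp_neg_sub_one_add_le hre
    have h3 : 0 ≤ 1 - Real.exp (-x) := by
      have : Real.exp (-x) ≤ 1 := Real.exp_le_one_iff.2 (by linarith)
      linarith
    rw [norm_mul, Complex.norm_real, Real.norm_of_nonneg hx.le, mul_pow] at h1
    rw [norm_mul, Complex.norm_real, Real.norm_of_nonneg (by positivity)]
    have h4 := one_sub_exp_neg_le x
    calc _ ≤ ‖z‖ ^ 2 * x ^ 2 + ‖z‖ * (x * x) := by gcongr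
      _ ≤ R ^ 2 * x ^ 2 + R * (x * x) := by gcongr
      _ = _ := by ring
  · refine (norm_add_le _ _).trans (add_le_add ?_ ?_)
    · refine (norm_sub_le _ _).trans ?_
      have : ‖Complex.exp (-(z * x))‖ ≤ 1 := by
        rw [Complex.norm_exp, Real.exp_le_one_iff, Complex.neg_re]; linarith
      rw [norm_one]; linarith
    · rw [norm_mul, Complex.norm_real, Real.norm_of_nonneg hxe]
      calc _ ≤ R * 1 := by gcongr; exact mul_exp_neg_le_one x
        _ = R := mul_one R

theorem norm_mul_rpow_le {w : ℂ} {C α x : ℝ} (hx : 0 < x) (h : ‖w‖ ≤ C * min 1 (x ^ 2)) :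
    ‖w * (x ^ (-1 - α) : ℝ)‖ ≤ C * (min 1 (x ^ 2) * x ^ (-1 - α)) := by
  rw [norm_mul, Complex.norm_real, Real.norm_of_nonneg (by positivity), ← mul_assoc]
  gcongr

theorem norm_exp_neg_sub_exp_neg_mul_le {z : ℂ} {δ R : ℝ} (hδ : 0 < δ) (hz : δ ≤ z.re)
    (hR : ‖z‖ ≤ R) {x : ℝ} (hx : 0 < x) :
    ‖(x : ℂ) * (Complex.exp (-(x : ℂ)) - Complex.exp (-(z * x)))‖ ≤
      (1 + R + (1 + 1 / δ)) * min 1 (x ^ 2) := by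
  have hR0 : 0 ≤ R := (norm_nonneg z).trans hR
  have hre : 0 ≤ (z * x).re := by
    have : 0 ≤ z.re := hδ.le.trans hz
    simp; positivity
  refine le_mul_min_one_sq (by positivity) (by positivity) ?_ ?_
  · rw [norm_mul, Complex.norm_real, Real.norm_of_nonneg hx.le]
    have h := norm_exp_neg_sub_exp_neg_le (w := (x : ℂ)) (by simpa using hx.le) hre
    have h2 : ‖(x : ℂ) - z * x‖ ≤ (1 + R) * x := by
      refine (norm_sub_le _ _).trans ?_
      rw [norm_mul, Complex.norm_real, Real.norm_of_nonneg hx.le]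
      nlinarith
    calc _ ≤ x * ((1 + R) * x) := by gcongr; exact h.trans h2
      _ = _ := by ring
  · rw [mul_sub]
    refine (norm_sub_le _ _).trans (add_le_add ?_ ?_)
    · rw [norm_mul, Complex.norm_real, Real.norm_of_nonneg hx.le, Complex.norm_exp]
      simpa using mul_exp_neg_le_one x
    · rw [norm_mul, Complex.norm_real, Real.norm_of_nonneg hx.le, Complex.norm_exp]
      have h : -(z * x).re ≤ -(δ * x) := by
        simp only [Complex.mul_re, Complex.ofReal_re, Complex.ofReal_im, mul_zero, sub_zero,
          neg_le_neg_iff]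
        gcongr
      rw [Complex.neg_re, le_div_iff₀ hδ]
      calc _ ≤ x * Real.exp (-(δ * x)) * δ := by gcongr
        _ = (δ * x) * Real.exp (-(δ * x)) := by ring
        _ ≤ 1 := mul_exp_neg_le_one _

theorem norm_sq_mul_exp_neg_le {z : ℂ} {δ : ℝ} (hδ : 0 < δ) (hz : δ ≤ z.re)
    {x : ℝ} (hx : 0 < x) :
    ‖(x : ℂ) ^ 2 * Complex.exp (-(z * x))‖ ≤ (1 + 4 / δ ^ 2) * min 1 (x ^ 2) := by
  have h : -(z * x).re ≤ -(δ * x) := by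
    simp only [Complex.mul_re, Complex.ofReal_re, Complex.ofReal_im, mul_zero, sub_zero,
      neg_le_neg_iff]
    gcongr
  have hn : ‖(x : ℂ) ^ 2 * Complex.exp (-(z * x))‖ ≤ x ^ 2 * Real.exp (-(δ * x)) := by
    rw [norm_mul, norm_pow, Complex.norm_real, Real.norm_of_nonneg hx.le, Complex.norm_exp,
      Complex.neg_re]
    gcongr
  refine hn.trans (le_mul_min_one_sq zero_le_one (by positivity) ?_ ?_)
  · rw [one_mul]
    exact mul_le_of_le_one_right (by positivity)
      (Real.exp_le_one_iff.2 (by nlinarith))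
  · rw [le_div_iff₀ (by positivity)]
    have h1 := mul_exp_neg_le_one (δ * x / 2)
    have h0 : 0 ≤ δ * x / 2 * Real.exp (-(δ * x / 2)) := by positivity
    calc x ^ 2 * Real.exp (-(δ * x)) * δ ^ 2
        = 4 * (δ * x / 2 * Real.exp (-(δ * x / 2))) ^ 2 := by
          rw [mul_pow, ← Real.exp_nat_mul]
          have : (2 : ℕ) * -(δ * x / 2) = -(δ * x) := by push_cast; ring
          rw [this]; ring
      _ ≤ 4 * 1 ^ 2 := by gcongr
      _ = 4 := by norm_num

/-- First derivative of `levyExponent`. -/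
noncomputable def levyExponentDeriv (α : ℝ) (z : ℂ) : ℂ :=
  ∫ x in Set.Ioi (0 : ℝ),
    ((x : ℂ) * (Complex.exp (-(x : ℂ)) - Complex.exp (-(z * x)))) * (x ^ (-1 - α) : ℝ)

/-- Second derivative of `levyExponent`. -/
noncomputable def levyExponentDerivTwo (α : ℝ) (z : ℂ) : ℂ :=
  ∫ x in Set.Ioi (0 : ℝ), ((x : ℂ) ^ 2 * Complex.exp (-(z * x))) * (x ^ (-1 - α) : ℝ)

section LevyExponent

variable {α : ℝ}

theorem integrableOn_of_norm_le_min {f : ℝ → ℂ} (h0 : 0 < α) (h2 : α < 2) {C : ℝ}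
    (hf : Measurable f) (h : ∀ x, 0 < x → ‖f x‖ ≤ C * min 1 (x ^ 2)) :
    IntegrableOn (fun x ↦ f x * (x ^ (-1 - α) : ℝ)) (Set.Ioi 0) := by
  refine Integrable.mono' ((integrableOn_min_one_sq_mul_rpow h0 h2).const_mul C)
    (Measurable.aestronglyMeasurable (by fun_prop)) ?_
  exact ae_restrict_of_forall_mem measurableSet_Ioi fun x hx ↦ norm_mul_rpow_le hx (h x hx)

theorem ball_half_re_subset {z w : ℂ} (hw : w ∈ Metric.ball z (z.re / 2)) :
    z.re / 2 ≤ w.re ∧ ‖w‖ ≤ ‖z‖ + z.re / 2 := by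
  rw [Metric.mem_ball, dist_eq_norm] at hw
  have h1 := (Complex.abs_re_le_norm (w - z)).trans hw.le
  rw [Complex.sub_re, abs_le] at h1
  have h2 := norm_le_norm_add_norm_sub' w z
  exact ⟨by linarith, by linarith⟩

theorem hasDerivAt_levyExponent (h0 : 0 < α) (h2 : α < 2) {z : ℂ} (hz : 0 < z.re) :
    HasDerivAt (levyExponent α) (levyExponentDeriv α z) z := by
  set δ := z.re / 2
  have hδ : 0 < δ := by positivity
  set R := ‖z‖ + δ
  refine (hasDerivAt_integral_of_dominated_loc_of_deriv_le (s := Metric.ball z δ)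
    (F := (fun (z : ℂ) (x : ℝ) ↦
      (Complex.exp (-(z * x)) - 1 + z * (x * Real.exp (-x) : ℝ)) * (x ^ (-1 - α) : ℝ)))
    (F' := (fun (z : ℂ) (x : ℝ) ↦
      ((x : ℂ) * (Complex.exp (-(x : ℂ)) - Complex.exp (-(z * x)))) * (x ^ (-1 - α) : ℝ)))
    (bound := fun x ↦ (1 + R + (1 + 1 / δ)) * (min 1 (x ^ 2) * x ^ (-1 - α)))
    (Metric.ball_mem_nhds z hδ) (Filter.Eventually.of_forall fun w ↦
      Measurable.aestronglyMeasurable (by fun_prop)) ?_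
    (Measurable.aestronglyMeasurable (by fun_prop)) ?_ ?_ ?_).2
  · exact integrableOn_of_norm_le_min h0 h2 (by fun_prop) fun x hx ↦
      norm_levy_integrand_le hz.le le_rfl hx
  · refine ae_restrict_of_forall_mem measurableSet_Ioi fun x hx w hw ↦ ?_
    obtain ⟨hw1, hw2⟩ := ball_half_re_subset hw
    exact norm_mul_rpow_le hx (norm_exp_neg_sub_exp_neg_mul_le hδ hw1 hw2 hx)
  · exact (integrableOn_min_one_sq_mul_rpow h0 h2).const_mul _
  · refine ae_of_all _ fun x w _ ↦ ?_
    have hd : HasDerivAt (fun w : ℂ ↦ Complex.exp (-(w * x))) (Complex.exp (-(w * x)) * -(1 * x)) w :=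
      (((hasDerivAt_id w).mul_const (x : ℂ)).neg).cexp
    have hd2 := ((hd.sub_const 1).add
      ((hasDerivAt_id w).mul_const ((x * Real.exp (-x) : ℝ) : ℂ))).mul_const
      ((x ^ (-1 - α) : ℝ) : ℂ)
    refine hd2.congr_deriv ?_
    push_cast
    ring

theorem hasDerivAt_levyExponentDeriv (h0 : 0 < α) (h2 : α < 2) {z : ℂ} (hz : 0 < z.re) :
    HasDerivAt (levyExponentDeriv α) (levyExponentDerivTwo α z) z := by
  set δ := z.re / 2
  have hδ : 0 < δ := by positivity
  refine (hasDerivAt_integral_of_dominated_loc_of_deriv_le (s := Metric.ball z δ)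
    (F := (fun (z : ℂ) (x : ℝ) ↦
      ((x : ℂ) * (Complex.exp (-(x : ℂ)) - Complex.exp (-(z * x)))) * (x ^ (-1 - α) : ℝ)))
    (F' := (fun (z : ℂ) (x : ℝ) ↦
      ((x : ℂ) ^ 2 * Complex.exp (-(z * x))) * (x ^ (-1 - α) : ℝ)))
    (bound := fun x ↦ (1 + 4 / δ ^ 2) * (min 1 (x ^ 2) * x ^ (-1 - α)))
    (Metric.ball_mem_nhds z hδ) (Filter.Eventually.of_forall fun w ↦
      Measurable.aestronglyMeasurable (by fun_prop)) ?_
    (Measurable.aestronglyMeasurable (by fun_prop)) ?_ ?_ ?_).2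
  · exact integrableOn_of_norm_le_min h0 h2 (by fun_prop) fun x hx ↦
      norm_exp_neg_sub_exp_neg_mul_le hz le_rfl le_rfl hx
  · refine ae_restrict_of_forall_mem measurableSet_Ioi fun x hx w hw ↦ ?_
    exact norm_mul_rpow_le hx (norm_sq_mul_exp_neg_le hδ (ball_half_re_subset hw).1 hx)
  · exact (integrableOn_min_one_sq_mul_rpow h0 h2).const_mul _
  · refine ae_of_all _ fun x w _ ↦ ?_
    have hd : HasDerivAt (fun w : ℂ ↦ Complex.exp (-(w * x))) (Complex.exp (-(w * x)) * -(1 * x)) w :=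
      (((hasDerivAt_id w).mul_const (x : ℂ)).neg).cexp
    have hd2 := ((hd.const_sub (Complex.exp (-(x : ℂ)))).const_mul (x : ℂ)).mul_const
      ((x ^ (-1 - α) : ℝ) : ℂ)
    refine hd2.congr_deriv ?_
    ring

/-- Two derivatives remove both the `-1` and the compensator, leaving a Gamma integral that
converges for all `α < 2`, the case `α = 1` included. -/
theorem levyExponentDerivTwo_ofReal (h2 : α < 2) {r : ℝ} (hr : 0 < r) :
    levyExponentDerivTwo α r = Real.Gamma (2 - α) * (r : ℂ) ^ ((α : ℂ) - 2) := by
  have h := Complex.integral_cpow_mul_exp_neg_mul_Ioi (a := 2 - α) (r := r) (by simpa using h2) hr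
  have e : (1 / (r : ℂ)) ^ ((2 : ℂ) - α) = (r : ℂ) ^ ((α : ℂ) - 2) := by
    rw [one_div, Complex.inv_cpow _ _ (by rw [Complex.arg_ofReal_of_nonneg hr.le]; exact Real.pi_pos.ne),
      ← Complex.cpow_neg]
    congr 1; ring
  rw [e, mul_comm] at h
  have g : (Real.Gamma (2 - α) : ℂ) = Complex.Gamma (2 - α) := by
    rw [← Complex.Gamma_ofReal]; push_cast; rfl
  rw [g, ← h, levyExponentDerivTwo]
  refine setIntegral_congr_fun measurableSet_Ioi fun x hx ↦ ?_
  have hx : 0 < x := hx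
  have hx' : (x : ℂ) ≠ 0 := by exact_mod_cast hx.ne'
  rw [Complex.ofReal_cpow hx.le, mul_assoc, mul_comm (Complex.exp _), ← mul_assoc,
    ← Complex.cpow_natCast, ← Complex.cpow_add _ _ hx']
  congr 2
  push_cast; ring

/-- Identity theorem: both sides are holomorphic on the right half-plane and agree on the real ray
to the right of `1`. -/
theorem levyExponentDerivTwo_eq (h0 : 0 < α) (h2 : α < 2) {z : ℂ} (hz : 0 < z.re) :
    levyExponentDerivTwo α z = Real.Gamma (2 - α) * z ^ ((α : ℂ) - 2) := by
  have hopen : IsOpen {z : ℂ | 0 < z.re} := isOpen_lt continuous_const Complex.continuous_re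
  have hconn : IsPreconnected {z : ℂ | 0 < z.re} := (convex_halfSpace_re_gt 0).isPreconnected
  have hd1 : DifferentiableOn ℂ (levyExponentDeriv α) {z : ℂ | 0 < z.re} := fun w hw ↦
    (hasDerivAt_levyExponentDeriv h0 h2 hw).differentiableAt.differentiableWithinAt
  have hd2 : DifferentiableOn ℂ (levyExponentDerivTwo α) {z : ℂ | 0 < z.re} :=
    (hd1.deriv hopen).congr fun w hw ↦ (hasDerivAt_levyExponentDeriv h0 h2 hw).deriv.symm
  have hd3 : DifferentiableOn ℂ (fun z : ℂ ↦ Real.Gamma (2 - α) * z ^ ((α : ℂ) - 2))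
      {z : ℂ | 0 < z.re} := fun w hw ↦
    ((differentiableAt_id.cpow_const (Or.inl hw)).const_mul _).differentiableWithinAt
  refine (hd2.analyticOnNhd hopen).eqOn_of_preconnected_of_frequently_eq
    (hd3.analyticOnNhd hopen) hconn (z₀ := 1) (by simp) ?_ hz
  have ht : Filter.Tendsto (fun r : ℝ ↦ (r : ℂ)) (nhdsWithin 1 (Set.Ioi 1)) (nhdsWithin 1 {1}ᶜ) := by
    refine tendsto_nhdsWithin_iff.2 ⟨?_, ?_⟩
    · exact (Complex.continuous_ofReal.tendsto' 1 1 (by simp)).mono_left nhdsWithin_le_nhds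
    · filter_upwards [self_mem_nhdsWithin] with r hr
      have : (1 : ℝ) < r := hr
      simpa using this.ne'
  refine ht.frequently (Filter.Eventually.frequently ?_)
  filter_upwards [self_mem_nhdsWithin] with r hr
  exact levyExponentDerivTwo_ofReal h2 (zero_lt_one.trans hr)

theorem continuousOn_levyExponent (h0 : 0 < α) (h2 : α < 2) :
    ContinuousOn (levyExponent α) {z : ℂ | 0 ≤ z.re} := by
  intro z hz
  set R := ‖z‖ + 1
  refine continuousWithinAt_of_dominated
    (bound := fun x ↦ (R ^ 2 + R + (2 + R)) * (min 1 (x ^ 2) * x ^ (-1 - α)))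
    (Filter.Eventually.of_forall fun w ↦ Measurable.aestronglyMeasurable (by fun_prop)) ?_
    ((integrableOn_min_one_sq_mul_rpow h0 h2).const_mul _) ?_
  · filter_upwards [self_mem_nhdsWithin,
      mem_nhdsWithin_of_mem_nhds (Metric.ball_mem_nhds z zero_lt_one)] with w hw hw1
    refine ae_restrict_of_forall_mem measurableSet_Ioi fun x hx ↦ ?_
    rw [Metric.mem_ball, dist_eq_norm] at hw1
    have := norm_le_norm_add_norm_sub' w z
    exact norm_mul_rpow_le hx (norm_levy_integrand_le hw (by linarith) hx)
  · exact ae_of_all _ fun x ↦ Continuous.continuousWithinAt (by fun_prop)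

theorem levyExponent_zero : levyExponent α 0 = 0 := by
  simp [levyExponent]

/-- `levyExponent α` is determined by its second derivative, and its values at `0` and derivative
at `1`. -/
theorem levyExponent_eq_of_hasDerivAt (h0 : 0 < α) (h2 : α < 2) {G G' : ℂ → ℂ}
    (hG : ∀ z : ℂ, 0 < z.re → HasDerivAt G (G' z) z)
    (hG' : ∀ z : ℂ, 0 < z.re → HasDerivAt G' (z ^ ((α : ℂ) - 2)) z) (h1 : G' 1 = 0)
    (hlim : Filter.Tendsto (fun r : ℝ ↦ G r) (nhdsWithin 0 (Set.Ioi 0)) (nhds 0))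
    {z : ℂ} (hz : 0 < z.re) : levyExponent α z = Real.Gamma (2 - α) * G z := by
  have hopen : IsOpen {z : ℂ | 0 < z.re} := isOpen_lt continuous_const Complex.continuous_re
  have hconn : IsPreconnected {z : ℂ | 0 < z.re} := (convex_halfSpace_re_gt 0).isPreconnected
  set c : ℂ := ((Real.Gamma (2 - α) : ℝ) : ℂ)
  -- The first derivatives agree at `1`, where both vanish: the factor `exp (-x)` in the compensator
  -- makes `levyExponentDeriv α 1 = 0`.
  have hA (w : ℂ) (hw : 0 < w.re) : levyExponentDeriv α w - c * G' w = 0 := by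
    have hd (w : ℂ) (hw : 0 < w.re) :
        HasDerivAt (fun w ↦ levyExponentDeriv α w - c * G' w) 0 w := by
      refine ((hasDerivAt_levyExponentDeriv h0 h2 hw).sub ((hG' w hw).const_mul c)).congr_deriv ?_
      rw [levyExponentDerivTwo_eq h0 h2 hw, sub_self]
    have := hopen.is_const_of_deriv_eq_zero hconn
      (fun w hw ↦ (hd w hw).differentiableAt.differentiableWithinAt)
      (fun w hw ↦ (hd w hw).deriv) (x := w) (y := 1) hw (by simp)
    rw [this, h1]
    simp [levyExponentDeriv]
  have hd (w : ℂ) (hw : 0 < w.re) :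
      HasDerivAt (fun w ↦ levyExponent α w - c * G w) 0 w :=
    ((hasDerivAt_levyExponent h0 h2 hw).sub ((hG w hw).const_mul c)).congr_deriv (hA w hw)
  obtain ⟨k, hk⟩ := hopen.exists_is_const_of_deriv_eq_zero hconn
      (fun w hw ↦ (hd w hw).differentiableAt.differentiableWithinAt)
      (fun w hw ↦ (hd w hw).deriv)
  -- The remaining additive constant is identified by letting `r` decrease to `0` along the positive
  -- reals.
  have ht1 : Filter.Tendsto (fun r : ℝ ↦ levyExponent α r) (nhdsWithin 0 (Set.Ioi 0)) (nhds 0) := by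
    have hc := (continuousOn_levyExponent h0 h2) 0 (by simp)
    rw [ContinuousWithinAt, levyExponent_zero] at hc
    refine hc.comp (tendsto_nhdsWithin_iff.2 ⟨?_, ?_⟩)
    · exact (Complex.continuous_ofReal.tendsto' 0 0 (by simp)).mono_left nhdsWithin_le_nhds
    · filter_upwards [self_mem_nhdsWithin] with r hr
      have : (0 : ℝ) < r := hr
      simpa using this.le
  have ht2 : Filter.Tendsto (fun r : ℝ ↦ levyExponent α r - c * G r)
      (nhdsWithin 0 (Set.Ioi 0)) (nhds 0) := by
    simpa using ht1.sub (hlim.const_mul c)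
  have ht3 : Filter.Tendsto (fun r : ℝ ↦ levyExponent α r - c * G r)
      (nhdsWithin 0 (Set.Ioi 0)) (nhds k) := by
    refine tendsto_const_nhds.congr' ?_
    filter_upwards [self_mem_nhdsWithin] with r hr
    exact (hk r (by simpa using hr)).symm
  have hk0 := tendsto_nhds_unique ht3 ht2
  have := hk z hz
  rw [hk0, sub_eq_zero] at this
  exact this

/-- The formula for `levyExponent α` extends to the imaginary axis by continuity. -/
theorem levyExponent_mul_I_of_continuousAt (h0 : 0 < α) (h2 : α < 2) {G : ℂ → ℂ} {c : ℂ}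
    (h : ∀ z : ℂ, 0 < z.re → levyExponent α z = c * G z) {t : ℝ}
    (hc : ContinuousAt G (t * Complex.I)) :
    levyExponent α (t * Complex.I) = c * G (t * Complex.I) := by
  have ht : Filter.Tendsto (fun r : ℝ ↦ (r : ℂ) + t * Complex.I) (nhdsWithin 0 (Set.Ioi 0))
      (nhds (t * Complex.I)) := by
    have : Continuous fun r : ℝ ↦ (r : ℂ) + t * Complex.I := by fun_prop
    exact (this.tendsto' 0 _ (by simp)).mono_left nhdsWithin_le_nhds
  have h1 : Filter.Tendsto (fun r : ℝ ↦ levyExponent α (r + t * Complex.I))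
      (nhdsWithin 0 (Set.Ioi 0)) (nhds (levyExponent α (t * Complex.I))) := by
    refine ((continuousOn_levyExponent h0 h2) (t * Complex.I) (by simp)).tendsto.comp
      (tendsto_nhdsWithin_iff.2 ⟨ht, ?_⟩)
    filter_upwards [self_mem_nhdsWithin] with r hr
    have : (0 : ℝ) < r := hr
    simpa using this.le
  refine tendsto_nhds_unique h1 (((hc.tendsto.comp ht).const_mul c).congr' ?_)
  filter_upwards [self_mem_nhdsWithin] with r hr
  exact (h _ (by simpa using hr)).symm

end LevyExponent

/-! ### Lévy's existence theorem and compound Poisson laws. -/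

/-- **Lévy's existence theorem**: a pointwise limit of characteristic functions which is continuous
at the origin is a characteristic function. -/
theorem exists_charFun_eq_of_tendsto {μ : ℕ → Measure ℝ} [hμ : ∀ i, IsProbabilityMeasure (μ i)]
    {f : ℝ → ℂ} (hf : ContinuousAt f 0)
    (h : ∀ t, Filter.Tendsto (fun n ↦ charFun (μ n) t) Filter.atTop (nhds (f t))) :
    ∃ ρ : Measure ℝ, IsProbabilityMeasure ρ ∧ ∀ t, charFun ρ t = f t := by
  -- Continuity of the limit at `0` gives tightness; Prokhorov's theorem then provides a weak limit
  -- along a subsequence.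
  have ht := isTightMeasureSet_of_tendsto_charFun hf h
  set m : ℕ → ProbabilityMeasure ℝ := fun n ↦ ⟨μ n, hμ n⟩
  have hset : {((μ : ProbabilityMeasure ℝ) : Measure ℝ) | μ ∈ Set.range m} = Set.range μ := by
    ext ν
    constructor
    · rintro ⟨_, ⟨n, rfl⟩, rfl⟩
      exact ⟨n, rfl⟩
    · rintro ⟨n, rfl⟩
      exact ⟨m n, ⟨n, rfl⟩, rfl⟩
  have hc := isCompact_closure_of_isTightMeasureSet (S := Set.range m) (by rwa [hset])
  obtain ⟨ρ, -, φ, hφ, hlim⟩ := hc.tendsto_subseq (x := m) fun n ↦ subset_closure ⟨n, rfl⟩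
  refine ⟨ρ, inferInstance, fun t ↦ ?_⟩
  have h1 := ProbabilityMeasure.tendsto_iff_tendsto_charFun.1 hlim t
  exact tendsto_nhds_unique h1 ((h t).comp hφ.tendsto_atTop)

theorem conv_mono {μ μ' ν ν' : Measure ℝ} [SFinite ν'] (h1 : μ ≤ μ') (h2 : ν ≤ ν') :
    μ.conv ν ≤ μ'.conv ν' :=
  Measure.map_mono (Measure.prod_mono h1 h2) (by fun_prop)

theorem measure_univ_conv (μ ν : Measure ℝ) [SFinite ν] :
    (μ.conv ν) Set.univ = μ Set.univ * ν Set.univ := by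
  rw [Measure.conv, Measure.map_apply (by fun_prop) MeasurableSet.univ, Set.preimage_univ,
    ← Set.univ_prod_univ, Measure.prod_prod]

/-- Convolution powers of a measure. -/
noncomputable def convPow (Λ : Measure ℝ) : ℕ → Measure ℝ
  | 0 => Measure.dirac 0
  | k + 1 => (convPow Λ k).conv Λ

section CompoundPoisson

variable (Λ : Measure ℝ) [IsFiniteMeasure Λ]

instance isFiniteMeasure_convPow (k : ℕ) : IsFiniteMeasure (convPow Λ k) := by
  induction k with
  | zero => rw [convPow]; infer_instance
  | succ k ih => rw [convPow]; infer_instance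

theorem measure_univ_convPow (k : ℕ) : convPow Λ k Set.univ = Λ Set.univ ^ k := by
  induction k with
  | zero => simp [convPow]
  | succ k ih => rw [convPow, measure_univ_conv, ih, pow_succ]

theorem charFun_convPow (k : ℕ) (t : ℝ) : charFun (convPow Λ k) t = charFun Λ t ^ k := by
  induction k with
  | zero => simp [convPow, charFun_dirac]
  | succ k ih => rw [convPow, charFun_conv, ih, pow_succ]

/-- The compound Poisson law with jump measure `Λ`. -/
noncomputable def compoundPoisson : Measure ℝ :=
  Measure.sum fun k : ℕ ↦
    ENNReal.ofReal (Real.exp (-Λ.real Set.univ) / k.factorial) • convPow Λ k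

instance isProbabilityMeasure_compoundPoisson : IsProbabilityMeasure (compoundPoisson Λ) := by
  constructor
  rw [compoundPoisson, Measure.sum_apply _ MeasurableSet.univ]
  set l := Λ.real Set.univ
  have hl : 0 ≤ l := measureReal_nonneg
  have h1 (k : ℕ) : (ENNReal.ofReal (Real.exp (-l) / k.factorial) • convPow Λ k) Set.univ =
      ENNReal.ofReal (Real.exp (-l) * (l ^ k / k.factorial)) := by
    rw [Measure.smul_apply, measure_univ_convPow, smul_eq_mul, ← ofReal_measureReal,
      ← ENNReal.ofReal_pow hl, ← ENNReal.ofReal_mul (by positivity)]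
    congr 1
    ring
  simp_rw [h1]
  have hs : HasSum (fun k : ℕ ↦ Real.exp (-l) * (l ^ k / k.factorial)) (Real.exp (-l) * Real.exp l) := by
    rw [Real.exp_eq_exp_ℝ]
    exact (NormedSpace.expSeries_div_hasSum_exp l).mul_left _
  rw [← ENNReal.ofReal_tsum_of_nonneg (fun k ↦ by positivity) hs.summable, hs.tsum_eq,
    ← Real.exp_add]
  simp

theorem charFun_compoundPoisson (t : ℝ) :
    charFun (compoundPoisson Λ) t = Complex.exp (charFun Λ t - Λ.real Set.univ) := by
  set l := Λ.real Set.univ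
  have hint : Integrable (fun x : ℝ ↦ Complex.exp (t * x * Complex.I)) (compoundPoisson Λ) := by
    refine Integrable.of_bound (C := 1) (Measurable.aestronglyMeasurable (by fun_prop))
      (ae_of_all _ fun x ↦ ?_)
    have := Complex.norm_exp_ofReal_mul_I (t * x)
    push_cast at this
    rw [this]
  have h1 : HasSum (fun k : ℕ ↦ ∫ x : ℝ, Complex.exp (t * x * Complex.I)
        ∂(ENNReal.ofReal (Real.exp (-l) / k.factorial) • convPow Λ k))
      (∫ x : ℝ, Complex.exp (t * x * Complex.I) ∂(compoundPoisson Λ)) :=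
    hasSum_integral_measure hint
  have h2 : HasSum (fun k : ℕ ↦ Complex.exp (-l) * (charFun Λ t ^ k / k.factorial))
      (Complex.exp (-l) * Complex.exp (charFun Λ t)) := by
    rw [Complex.exp_eq_exp_ℂ]
    exact (NormedSpace.expSeries_div_hasSum_exp (charFun Λ t)).mul_left _
  have h3 (k : ℕ) : ∫ x : ℝ, Complex.exp (t * x * Complex.I)
        ∂(ENNReal.ofReal (Real.exp (-l) / k.factorial) • convPow Λ k) =
      Complex.exp (-l) * (charFun Λ t ^ k / k.factorial) := by
    rw [integral_smul_measure, ← charFun_apply_real, charFun_convPow,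
      ENNReal.toReal_ofReal (by positivity), Complex.real_smul]
    push_cast
    ring
  simp_rw [h3] at h1
  rw [charFun_apply_real, h1.unique h2, ← Complex.exp_add]
  congr 1
  ring

/-- Only the term `k = 1`, exactly one jump, is kept. -/
theorem smul_le_compoundPoisson :
    ENNReal.ofReal (Real.exp (-Λ.real Set.univ)) • Λ ≤ compoundPoisson Λ := by
  have h := Measure.le_sum (fun k : ℕ ↦
    ENNReal.ofReal (Real.exp (-Λ.real Set.univ) / k.factorial) • convPow Λ k) 1
  simpa [convPow, compoundPoisson] using h

end CompoundPoisson

/-! ### One-sided stable laws and their large jumps. -/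

/-- The measure with density `c * x ^ (-1 - α)` on `S`. -/
noncomputable def powerLevyMeasure (α c : ℝ) (S : Set ℝ) : Measure ℝ :=
  (volume.restrict S).withDensity fun x ↦ ENNReal.ofReal (c * x ^ (-1 - α))

section PowerLevyMeasure

variable {α c : ℝ} {S : Set ℝ} {δ : ℝ}

theorem integrableOn_rpow_of_subset (h0 : 0 < α) (hδ : 0 < δ) (hSδ : S ⊆ Set.Ioi δ) :
    IntegrableOn (fun x : ℝ ↦ x ^ (-1 - α)) S :=
  (integrableOn_Ioi_rpow_of_lt (by linarith) hδ).mono_set hSδ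

theorem isFiniteMeasure_powerLevyMeasure (c : ℝ) (h0 : 0 < α) (hδ : 0 < δ)
    (hSδ : S ⊆ Set.Ioi δ) : IsFiniteMeasure (powerLevyMeasure α c S) :=
  isFiniteMeasure_withDensity_ofReal
    (((integrableOn_rpow_of_subset h0 hδ hSδ).const_mul c).hasFiniteIntegral)

theorem charFun_powerLevyMeasure_sub (hc : 0 < c) (h0 : 0 < α) (hδ : 0 < δ)
    (hS : MeasurableSet S) (hSδ : S ⊆ Set.Ioi δ) (t : ℝ) :
    charFun (powerLevyMeasure α c S) t - (powerLevyMeasure α c S).real Set.univ =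
      c * ∫ x in S, (Complex.exp (-(-(t * Complex.I) * x)) - 1) * (x ^ (-1 - α) : ℝ) := by
  have := isFiniteMeasure_powerLevyMeasure c h0 hδ hSδ
  have hint : Integrable (fun x : ℝ ↦ Complex.exp (t * x * Complex.I))
      (powerLevyMeasure α c S) := by
    refine Integrable.of_bound (C := 1) (Measurable.aestronglyMeasurable (by fun_prop))
      (ae_of_all _ fun x ↦ ?_)
    have := Complex.norm_exp_ofReal_mul_I (t * x)
    push_cast at this
    rw [this]
  have h1 : charFun (powerLevyMeasure α c S) t - (powerLevyMeasure α c S).real Set.univ =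
      ∫ x : ℝ, (Complex.exp (t * x * Complex.I) - 1) ∂(powerLevyMeasure α c S) := by
    rw [integral_sub hint (integrable_const _), charFun_apply_real]
    simp
  rw [h1, powerLevyMeasure, integral_withDensity_eq_integral_toReal_smul (by fun_prop)
    (ae_of_all _ fun x ↦ ENNReal.ofReal_lt_top), ← integral_const_mul]
  refine setIntegral_congr_fun hS fun x hx ↦ ?_
  have hx : 0 < x := hδ.trans (hSδ hx)
  rw [ENNReal.toReal_ofReal (by positivity), Complex.real_smul,
    show -(-((t : ℂ) * Complex.I) * x) = t * x * Complex.I by ring]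
  push_cast
  ring

theorem integrableOn_exp_sub_one_mul_rpow (h0 : 0 < α) (hδ : 0 < δ) (hSδ : S ⊆ Set.Ioi δ) (t : ℝ) :
    IntegrableOn (fun x : ℝ ↦
      (Complex.exp (-(-(t * Complex.I) * x)) - 1) * (x ^ (-1 - α) : ℝ)) S := by
  refine Integrable.bdd_mul (c := 2) (integrableOn_rpow_of_subset h0 hδ hSδ).ofReal
    (Measurable.aestronglyMeasurable (by fun_prop)) (ae_of_all _ fun x ↦ ?_)
  refine (norm_sub_le _ _).trans ?_
  rw [show -(-((t : ℂ) * Complex.I) * x) = (t * x : ℝ) * Complex.I by push_cast; ring,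
    Complex.norm_exp_ofReal_mul_I, norm_one]
  norm_num

end PowerLevyMeasure

/-- The one-sided stable law with Laplace exponent `c * levyExponent α` splits off a multiple of
its large jumps. -/
theorem exists_oneSided_stable {α c : ℝ} (h0 : 0 < α) (h2 : α < 2) (hc : 0 < c) :
    ∃ U ρ : Measure ℝ, IsProbabilityMeasure U ∧ IsProbabilityMeasure ρ ∧
      (∀ t : ℝ, charFun U t = Complex.exp (c * levyExponent α (-(t * Complex.I)))) ∧
      ∃ κ : ℝ, 0 < κ ∧
        (ENNReal.ofReal κ • powerLevyMeasure α c (Set.Ioi 1)).conv ρ ≤ U := by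
  set Λ := powerLevyMeasure α c (Set.Ioi 1)
  have : IsFiniteMeasure Λ := isFiniteMeasure_powerLevyMeasure c h0 zero_lt_one subset_rfl
  set δ : ℕ → ℝ := fun n ↦ 1 / ((n : ℝ) + 1) with hδdef
  have hδ (n : ℕ) : 0 < δ n := Nat.one_div_pos_of_nat
  have hδ1 (n : ℕ) : δ n ≤ 1 := by
    rw [hδdef]; simp only; rw [div_le_one (by positivity)]; linarith [(n.cast_nonneg : (0:ℝ) ≤ n)]
  have hsub (n : ℕ) : Set.Ioc (δ n) 1 ⊆ Set.Ioi (δ n) := fun x hx ↦ hx.1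
  set Λs : ℕ → Measure ℝ := fun n ↦ powerLevyMeasure α c (Set.Ioc (δ n) 1)
  have hfin (n : ℕ) : IsFiniteMeasure (Λs n) :=
    isFiniteMeasure_powerLevyMeasure c h0 (hδ n) (hsub n)
  -- The drift compensates over all of `(δ n, ∞)`, although only the jumps in `(δ n, 1]` are used
  -- here: the large jumps, added back at the end, then need no compensation of their own.
  set b : ℕ → ℝ := fun n ↦ c * ∫ x in Set.Ioi (δ n), (x * Real.exp (-x)) * x ^ (-1 - α) with hb
  set F : ℝ → ℝ → ℂ := fun t x ↦
    (Complex.exp (-(-(t * Complex.I) * x)) - 1 + -(t * Complex.I) * (x * Real.exp (-x) : ℝ)) *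
      (x ^ (-1 - α) : ℝ) with hF
  have hFint (t : ℝ) : IntegrableOn (F t) (Set.Ioi 0) :=
    integrableOn_of_norm_le_min h0 h2 (by fun_prop) fun x hx ↦
      norm_levy_integrand_le (by simp) le_rfl hx
  -- The compensated jumps of size in `(δ n, 1]`: the full truncated exponent with the factor of the
  -- large jumps divided out.
  have hchar (n : ℕ) (t : ℝ) :
      charFun ((compoundPoisson (Λs n)).conv (Measure.dirac (-b n))) t =
        Complex.exp (c * ∫ x in Set.Ioi (δ n), F t x) *
          Complex.exp (-(charFun Λ t - Λ.real Set.univ)) := by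
    have hi1 := integrableOn_exp_sub_one_mul_rpow h0 (hδ n) subset_rfl t
    have hi2 : IntegrableOn (fun x : ℝ ↦
        -(t * Complex.I) * (((x * Real.exp (-x)) * x ^ (-1 - α) : ℝ) : ℂ)) (Set.Ioi (δ n)) := by
      refine (((integrableOn_rpow_of_subset h0 (hδ n) subset_rfl).bdd_mul (c := 1)
        (f := fun x ↦ x * Real.exp (-x)) (Measurable.aestronglyMeasurable (by fun_prop)) ?_).ofReal).const_mul _
      refine ae_restrict_of_forall_mem measurableSet_Ioi fun x hx ↦ ?_
      have hx : 0 < x := (hδ n).trans hx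
      rw [Real.norm_of_nonneg (by positivity)]
      exact mul_exp_neg_le_one x
    have hsplit : ∫ x in Set.Ioi (δ n), F t x =
        (∫ x in Set.Ioc (δ n) 1,
          (Complex.exp (-(-(t * Complex.I) * x)) - 1) * (x ^ (-1 - α) : ℝ)) +
        (∫ x in Set.Ioi (1 : ℝ),
          (Complex.exp (-(-(t * Complex.I) * x)) - 1) * (x ^ (-1 - α) : ℝ)) +
        -(t * Complex.I) * ((∫ x in Set.Ioi (δ n), (x * Real.exp (-x)) * x ^ (-1 - α) : ℝ) : ℂ) := by
      rw [← setIntegral_union (Set.Ioc_disjoint_Ioi le_rfl) measurableSet_Ioi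
        (hi1.mono_set (hsub n)) (hi1.mono_set (Set.Ioi_subset_Ioi (hδ1 n))),
        Set.Ioc_union_Ioi_eq_Ioi (hδ1 n), ← integral_complex_ofReal, ← integral_const_mul,
        ← integral_add hi1 hi2]
      refine setIntegral_congr_fun measurableSet_Ioi fun x _ ↦ ?_
      simp only [hF]
      push_cast
      ring
    rw [charFun_conv, charFun_compoundPoisson, charFun_dirac,
      charFun_powerLevyMeasure_sub hc h0 (hδ n) measurableSet_Ioc (hsub n),
      charFun_powerLevyMeasure_sub hc h0 zero_lt_one measurableSet_Ioi subset_rfl, hsplit,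
      ← Complex.exp_add, ← Complex.exp_add]
    congr 1
    simp only [hb, RCLike.inner_apply, conj_trivial]
    push_cast
    ring
  have hlim (t : ℝ) : Filter.Tendsto (fun n ↦ ∫ x in Set.Ioi (δ n), F t x) Filter.atTop
      (nhds (levyExponent α (-(t * Complex.I)))) := by
    have hU : ⋃ n, Set.Ioi (δ n) = Set.Ioi 0 := by
      refine Set.Subset.antisymm (Set.iUnion_subset fun n ↦ Set.Ioi_subset_Ioi (hδ n).le) ?_
      intro x hx
      obtain ⟨n, hn⟩ := exists_nat_one_div_lt (show (0 : ℝ) < x from hx)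
      exact Set.mem_iUnion.2 ⟨n, hn⟩
    have := tendsto_setIntegral_of_monotone (s := fun n ↦ Set.Ioi (δ n)) (f := F t) (μ := volume)
      (fun n ↦ measurableSet_Ioi)
      (fun m n hmn ↦ Set.Ioi_subset_Ioi (Nat.one_div_le_one_div hmn)) (by rw [hU]; exact hFint t)
    rwa [hU] at this
  have hcontφ : ContinuousAt (fun t : ℝ ↦
      Complex.exp (c * levyExponent α (-(t * Complex.I))) *
        Complex.exp (-(charFun Λ t - Λ.real Set.univ))) 0 := by
    have h1 : Continuous fun t : ℝ ↦ levyExponent α (-(t * Complex.I)) := by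
      rw [← continuousOn_univ]
      exact (continuousOn_levyExponent h0 h2).comp (by fun_prop) fun t _ ↦ by simp
    have h3 : Continuous (charFun Λ) := continuous_charFun
    exact Continuous.continuousAt (by fun_prop)
  obtain ⟨ρ, hρ, hρchar⟩ := exists_charFun_eq_of_tendsto
    (μ := fun n ↦ (compoundPoisson (Λs n)).conv (Measure.dirac (-b n))) hcontφ fun t ↦ by
      simp_rw [hchar]
      exact (((hlim t).const_mul (c : ℂ)).cexp).mul_const _
  -- `ρ` is the limit law of the compensated small jumps; convolving with the compound Poisson law
  -- of the large jumps restores the full exponent.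
  refine ⟨(compoundPoisson Λ).conv ρ, ρ, inferInstance, hρ, fun t ↦ ?_,
    Real.exp (-Λ.real Set.univ), Real.exp_pos _, ?_⟩
  · rw [charFun_conv, charFun_compoundPoisson, hρchar, mul_comm, mul_assoc, ← Complex.exp_add]
    simp
  · exact conv_mono (smul_le_compoundPoisson Λ) le_rfl

/-! ### Lower bounds for densities of convolutions. -/

theorem conv_withDensity_map_neg {p q : ℝ → ℝ≥0∞} (hp : Measurable p) (hq : Measurable q) :
    (volume.withDensity p).conv ((volume.withDensity q).map fun x ↦ -x) =
      volume.withDensity fun x ↦ ∫⁻ z, p (x + z) * q z := by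
  refine Measure.ext_of_lintegral _ fun f hf ↦ ?_
  have hm : Measurable fun x ↦ ∫⁻ z, p (x + z) * q z :=
    Measurable.lintegral_prod_right' (f := fun z : ℝ × ℝ ↦ p (z.1 + z.2) * q z.2) (by fun_prop)
  rw [Measure.lintegral_conv hf, lintegral_withDensity_eq_lintegral_mul _ hm hf]
  have h1 (x : ℝ) : ∫⁻ y, f (x + y) ∂((volume.withDensity q).map fun x ↦ -x) =
      ∫⁻ z, q z * f (x - z) := by
    rw [lintegral_map (by fun_prop) (by fun_prop),
      lintegral_withDensity_eq_lintegral_mul _ hq (by fun_prop)]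
    rfl
  simp_rw [h1]
  have hm2 : Measurable fun x ↦ ∫⁻ z, q z * f (x - z) :=
    Measurable.lintegral_prod_right' (f := fun z : ℝ × ℝ ↦ q z.2 * f (z.1 - z.2)) (by fun_prop)
  rw [lintegral_withDensity_eq_lintegral_mul _ hp hm2]
  calc ∫⁻ y, (p * fun x ↦ ∫⁻ z, q z * f (x - z)) y
      = ∫⁻ y, ∫⁻ z, p y * (q z * f (y - z)) := by
        refine lintegral_congr fun y ↦ ?_
        rw [Pi.mul_apply, lintegral_const_mul _ (by fun_prop)]
    _ = ∫⁻ z, ∫⁻ y, p y * (q z * f (y - z)) := lintegral_lintegral_swap (by fun_prop)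
    _ = ∫⁻ z, ∫⁻ x, p (x + z) * (q z * f (x + z - z)) := by
        refine lintegral_congr fun z ↦ ?_
        exact (lintegral_add_right_eq_self (fun y ↦ p y * (q z * f (y - z))) z).symm
    _ = ∫⁻ x, ∫⁻ z, p (x + z) * (q z * f (x + z - z)) := lintegral_lintegral_swap (by fun_prop)
    _ = _ := by
        refine lintegral_congr fun x ↦ ?_
        rw [Pi.mul_apply, ← lintegral_mul_const _ (by fun_prop)]
        refine lintegral_congr fun z ↦ ?_
        rw [add_sub_cancel_right, mul_assoc]

/-- Translating `w` by `y` costs at most the factor `u y`, so a convolution with `ρ` costs at most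
the factor `∫ u dρ`. It lets a slowly decaying lower bound survive an uncontrolled independent
summand. -/
theorem withDensity_le_conv {w u : ℝ → ℝ≥0∞} (hw : Measurable w) (hu : Measurable u)
    (h : ∀ x y, u y * w x ≤ w (x - y)) (ρ : Measure ℝ) [SFinite ρ] :
    (∫⁻ y, u y ∂ρ) • volume.withDensity w ≤ (volume.withDensity w).conv ρ := by
  rw [Measure.conv_comm]
  refine Measure.le_intro fun s hs _ ↦ ?_
  have hf : Measurable (s.indicator (1 : ℝ → ℝ≥0∞)) := measurable_one.indicator hs
  rw [← lintegral_indicator_one hs, ← lintegral_indicator_one hs, Measure.lintegral_conv hf,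
    lintegral_smul_measure, smul_eq_mul, ← lintegral_mul_const _ hu]
  refine lintegral_mono fun y ↦ ?_
  rw [lintegral_withDensity_eq_lintegral_mul _ hw hf,
    lintegral_withDensity_eq_lintegral_mul _ hw (by fun_prop), ← lintegral_const_mul _ (by fun_prop)]
  refine le_of_le_of_eq (lintegral_mono fun x ↦ ?_) (lintegral_sub_right_eq_self
    (μ := volume) (fun x ↦ (w * fun x ↦ s.indicator (1 : ℝ → ℝ≥0∞) (y + x)) x) y)
  simp only [Pi.mul_apply]
  rw [add_sub_cancel, ← mul_assoc]
  gcongr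
  exact h x y

theorem powerLevyMeasure_eq_withDensity (α c : ℝ) {S : Set ℝ} (hS : MeasurableSet S) :
    powerLevyMeasure α c S =
      volume.withDensity (S.indicator fun x ↦ ENNReal.ofReal (c * x ^ (-1 - α))) := by
  rw [powerLevyMeasure, withDensity_indicator hS]

/-- The difference of two independent large jumps has a polynomially decaying lower bound for its
density on the whole line. -/
theorem withDensity_le_conv_powerLevyMeasure {α c₁ c₂ : ℝ} (h0 : 0 < α) (h1 : 0 < c₁)
    (h2 : 0 < c₂) : ∃ C : ℝ, 0 < C ∧
    volume.withDensity
        (fun x ↦ ENNReal.ofReal (C * Real.exp (-(2 * (1 + α) * Real.log (1 + |x|))))) ≤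
      (powerLevyMeasure α c₁ (Set.Ioi 1)).conv
        ((powerLevyMeasure α c₂ (Set.Ioi 1)).map fun x ↦ -x) := by
  -- With `T = 1 + |x|` and `z` in the unit window `(T, T + 1]`, both jumps `x + z` and `z` lie in
  -- `(1, 2 T]`; the constant collects the two densities at `2 T`.
  refine ⟨c₁ * c₂ * (2 ^ (-1 - α)) ^ 2, by positivity, ?_⟩
  rw [powerLevyMeasure_eq_withDensity _ _ measurableSet_Ioi,
    powerLevyMeasure_eq_withDensity _ _ measurableSet_Ioi,
    conv_withDensity_map_neg (Measurable.indicator (by fun_prop) measurableSet_Ioi)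
      (Measurable.indicator (by fun_prop) measurableSet_Ioi)]
  refine withDensity_mono (ae_of_all _ fun x ↦ ?_)
  set T := 1 + |x|
  have hT : 0 < T := by positivity
  have hxT := neg_abs_le x
  have hxT' := le_abs_self x
  calc ENNReal.ofReal (c₁ * c₂ * (2 ^ (-1 - α)) ^ 2 * Real.exp (-(2 * (1 + α) * Real.log T)))
      = ENNReal.ofReal (c₁ * (2 * T) ^ (-1 - α)) * ENNReal.ofReal (c₂ * (2 * T) ^ (-1 - α)) := by
        rw [← ENNReal.ofReal_mul (by positivity), Real.mul_rpow zero_le_two hT.le,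
          Real.rpow_def_of_pos hT]
        congr 1
        rw [show -(2 * (1 + α) * Real.log T) =
          Real.log T * (-1 - α) + Real.log T * (-1 - α) by ring, Real.exp_add]
        ring
    _ = ∫⁻ _ in Set.Ioc T (T + 1),
          ENNReal.ofReal (c₁ * (2 * T) ^ (-1 - α)) * ENNReal.ofReal (c₂ * (2 * T) ^ (-1 - α)) := by
        simp
    _ ≤ ∫⁻ z in Set.Ioc T (T + 1),
          (Set.Ioi 1).indicator (fun x ↦ ENNReal.ofReal (c₁ * x ^ (-1 - α))) (x + z) *
          (Set.Ioi 1).indicator (fun x ↦ ENNReal.ofReal (c₂ * x ^ (-1 - α))) z := by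
        refine setLIntegral_mono' measurableSet_Ioc fun z hz ↦ ?_
        have hz1 : 1 + |x| < z := hz.1
        have hz2 : z ≤ 1 + |x| + 1 := hz.2
        have habs := abs_nonneg x
        have e1 : 1 < x + z := by linarith
        have e2 : 1 < z := by linarith
        have hT2 : 2 * T = 2 + 2 * |x| := by ring
        rw [Set.indicator_of_mem (Set.mem_Ioi.2 e1), Set.indicator_of_mem (Set.mem_Ioi.2 e2)]
        refine mul_le_mul' (ENNReal.ofReal_le_ofReal ?_) (ENNReal.ofReal_le_ofReal ?_)
        · exact mul_le_mul_of_nonneg_left (Real.rpow_le_rpow_of_nonpos (by linarith) (by linarith)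
            (by linarith)) h1.le
        · exact mul_le_mul_of_nonneg_left (Real.rpow_le_rpow_of_nonpos (by linarith) (by linarith)
            (by linarith)) h2.le
    _ ≤ _ := setLIntegral_le_lintegral _ _

/-! ### The stable exponent as a combination of one-sided exponents. -/

section Exponent

variable {α : ℝ}

theorem ofReal_mul_I_mem_slitPlane {t : ℝ} (ht : t ≠ 0) : (t * Complex.I) ∈ Complex.slitPlane := by
  right; simpa using ht

/-- The bracket is the second primitive of `z ^ (α - 2)` with derivative `0` at `1` and limit `0` at
the origin, continued to the imaginary axis. -/
theorem levyExponent_mul_I_of_ne_one (h0 : 0 < α) (h2 : α < 2) (h1 : α ≠ 1) {t : ℝ} (ht : t ≠ 0) :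
    levyExponent α (t * Complex.I) = Real.Gamma (2 - α) *
      ((t * Complex.I) ^ (α : ℂ) / (α * (α - 1)) - t * Complex.I / (α - 1)) := by
  have hα : (α : ℂ) ≠ 0 := by exact_mod_cast h0.ne'
  have hα1 : (α : ℂ) - 1 ≠ 0 := by
    rw [sub_ne_zero]; exact_mod_cast h1
  refine levyExponent_mul_I_of_continuousAt h0 h2
    (G := fun z ↦ z ^ (α : ℂ) / (α * (α - 1)) - z / (α - 1)) (fun z hz ↦ ?_) ?_
  · refine levyExponent_eq_of_hasDerivAt h0 h2
      (G := fun z ↦ z ^ (α : ℂ) / (α * (α - 1)) - z / (α - 1))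
      (G' := fun z ↦ (z ^ ((α : ℂ) - 1) - 1) / (α - 1)) (fun w hw ↦ ?_) (fun w hw ↦ ?_)
      (by simp) ?_ hz
    · have hd := (((hasDerivAt_id w).cpow_const (c := (α : ℂ)) (Or.inl hw)).div_const
        ((α : ℂ) * (α - 1))).sub ((hasDerivAt_id w).div_const ((α : ℂ) - 1))
      refine hd.congr_deriv ?_
      simp only [id]
      field_simp
    · have hd := ((((hasDerivAt_id w).cpow_const (c := (α : ℂ) - 1) (Or.inl hw)).sub_const
        1).div_const ((α : ℂ) - 1))
      refine hd.congr_deriv ?_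
      simp only [id]
      rw [show (α : ℂ) - 1 - 1 = α - 2 by ring]
      field_simp
    · have hc : ContinuousAt (fun r : ℝ ↦ ((r ^ α : ℝ) : ℂ) / (α * (α - 1)) - r / (α - 1)) 0 := by
        have := Real.continuousAt_rpow_const 0 α (Or.inr h0.le)
        fun_prop
      have := hc.tendsto
      simp only [Real.zero_rpow h0.ne', Complex.ofReal_zero, zero_div, sub_zero] at this
      refine (this.mono_left nhdsWithin_le_nhds).congr' ?_
      filter_upwards [self_mem_nhdsWithin] with r hr
      have hr : (0 : ℝ) < r := hr
      rw [Complex.ofReal_cpow hr.le]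
  · have := continuousAt_cpow_const (b := (α : ℂ)) (ofReal_mul_I_mem_slitPlane ht)
    exact (this.div_const _).sub (continuousAt_id.div_const _)

/-- Same as for `α ≠ 1`, except that the primitive of `1 / z` is a logarithm. -/
theorem levyExponent_one_mul_I {t : ℝ} (ht : t ≠ 0) :
    levyExponent 1 (t * Complex.I) =
      t * Complex.I * Complex.log (t * Complex.I) - t * Complex.I := by
  have h := levyExponent_mul_I_of_continuousAt (α := 1) zero_lt_one one_lt_two (t := t)
    (G := fun z ↦ z * Complex.log z - z) (c := Real.Gamma (2 - 1)) (fun z hz ↦ ?_) ?_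
  · rw [h]
    norm_num
  · refine levyExponent_eq_of_hasDerivAt zero_lt_one one_lt_two
      (G := fun z ↦ z * Complex.log z - z)
      (G' := Complex.log) (fun w hw ↦ ?_) (fun w hw ↦ ?_) (by simp) ?_ hz
    · have hw0 : w ≠ 0 := by rintro rfl; simp at hw
      have hd := ((hasDerivAt_id w).mul (Complex.hasDerivAt_log (Or.inl hw))).sub (hasDerivAt_id w)
      refine hd.congr_deriv ?_
      simp [hw0]
    · refine (Complex.hasDerivAt_log (Or.inl hw)).congr_deriv ?_
      rw [← Complex.cpow_neg_one]
      congr 1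
      push_cast; norm_num
    · have hc : Continuous fun r : ℝ ↦ ((r * Real.log r : ℝ) : ℂ) - r := by
        have := Real.continuous_mul_log
        fun_prop
      refine ((hc.tendsto' 0 0 (by simp)).mono_left nhdsWithin_le_nhds).congr' ?_
      filter_upwards [self_mem_nhdsWithin] with r hr
      have hr : (0 : ℝ) < r := hr
      rw [Complex.ofReal_mul, Complex.ofReal_log hr.le]
  · have := continuousAt_id.clog (ofReal_mul_I_mem_slitPlane ht)
    exact (continuousAt_id.mul this).sub continuousAt_id

theorem log_ofReal_mul_I {t : ℝ} (ht : 0 < t) :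
    Complex.log (t * Complex.I) = Real.log t + Real.pi / 2 * Complex.I := by
  rw [Complex.log_ofReal_mul ht Complex.I_ne_zero, Complex.log_I]

theorem log_ofReal_mul_neg_I {t : ℝ} (ht : 0 < t) :
    Complex.log (((-t : ℝ) : ℂ) * Complex.I) = Real.log t - Real.pi / 2 * Complex.I := by
  rw [show ((-t : ℝ) : ℂ) * Complex.I = t * -Complex.I by push_cast; ring,
    Complex.log_ofReal_mul ht (neg_ne_zero.2 Complex.I_ne_zero), Complex.log_neg_I]
  ring

theorem cpow_ofReal_mul_I {t : ℝ} (ht : 0 < t) :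
    (t * Complex.I) ^ (α : ℂ) = (t ^ α : ℝ) *
      (Real.cos (Real.pi * α / 2) + Real.sin (Real.pi * α / 2) * Complex.I) := by
  have h : (t : ℂ) * Complex.I ≠ 0 := by simp [ht.ne']
  rw [Complex.cpow_def_of_ne_zero h, log_ofReal_mul_I ht, Real.rpow_def_of_pos ht]
  push_cast
  rw [← Complex.exp_mul_I, ← Complex.exp_add]
  congr 1
  ring

theorem cpow_ofReal_mul_neg_I {t : ℝ} (ht : 0 < t) :
    (((-t : ℝ) : ℂ) * Complex.I) ^ (α : ℂ) = (t ^ α : ℝ) *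
      (Real.cos (Real.pi * α / 2) - Real.sin (Real.pi * α / 2) * Complex.I) := by
  have h : ((-t : ℝ) : ℂ) * Complex.I ≠ 0 := by simp [ht.ne']
  rw [Complex.cpow_def_of_ne_zero h, log_ofReal_mul_neg_I ht, Real.rpow_def_of_pos ht]
  push_cast
  rw [show Complex.cos (Real.pi * α / 2) - Complex.sin (Real.pi * α / 2) * Complex.I =
    Complex.cos (-(Real.pi * α / 2)) + Complex.sin (-(Real.pi * α / 2)) * Complex.I by
      rw [Complex.cos_neg, Complex.sin_neg]; ring, ← Complex.exp_mul_I, ← Complex.exp_add]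
  congr 1
  ring

/-- `α - 1` and `cos (π α / 2)` have opposite signs. This makes the jump intensities below positive.
-/
theorem neg_mul_cos_pos (h0 : 0 < α) (h2 : α < 2) (h1 : α ≠ 1) :
    0 < -(α * (α - 1) * Real.cos (Real.pi * α / 2)) := by
  have hpi := Real.pi_pos
  rcases lt_or_gt_of_ne h1 with h | h
  · have hc : 0 < Real.cos (Real.pi * α / 2) :=
      Real.cos_pos_of_mem_Ioo ⟨by nlinarith, by nlinarith⟩
    have : 0 < α * (1 - α) * Real.cos (Real.pi * α / 2) :=
      mul_pos (mul_pos h0 (by linarith)) hc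
    linarith
  · have hc : Real.cos (Real.pi * α / 2) < 0 :=
      Real.cos_neg_of_pi_div_two_lt_of_lt (by nlinarith) (by nlinarith)
    have : 0 < α * (α - 1) * -Real.cos (Real.pi * α / 2) :=
      mul_pos (mul_pos h0 (by linarith)) (by linarith)
    linarith

/-- The stable characteristic function as a product of one-sided ones. -/
theorem exists_stableCharFun_eq_mul {β a c : ℝ} (h0 : 0 < α) (h2 : α < 2) (hβ : -1 < β)
    (hβ' : β < 1) (hc : 0 < c) :
    ∃ c₁ c₂ a' : ℝ, 0 < c₁ ∧ 0 < c₂ ∧ ∀ t : ℝ, 0 < t →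
      stableCharFun α β a c t = Complex.exp (c₁ * levyExponent α (-(t * Complex.I))) *
        Complex.exp (c₂ * levyExponent α (t * Complex.I)) * Complex.exp (a' * t * Complex.I) := by
  have hpi := Real.pi_pos
  by_cases h1 : α = 1
  · subst h1
    set s := 2 * c / Real.pi
    have hs : 0 < s := by positivity
    -- The real part fixes the sum `s` of the intensities and the skewness fixes their difference;
    -- strict bounds on `β` make both positive. The shift `-s * β` absorbs the linear term of
    -- `levyExponent 1`.
    refine ⟨s * (1 + β) / 2, s * (1 - β) / 2, a - s * β, ?_, ?_, fun t ht ↦ ?_⟩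
    · have : 0 < 1 + β := by linarith
      positivity
    · have : 0 < 1 - β := by linarith
      positivity
    · have e : -((t : ℂ) * Complex.I) = ((-t : ℝ) : ℂ) * Complex.I := by push_cast; ring
      rw [e, levyExponent_one_mul_I ht.ne', levyExponent_one_mul_I (neg_ne_zero.2 ht.ne'),
        log_ofReal_mul_I ht, log_ofReal_mul_neg_I ht, stableCharFun, stableOmega, if_pos rfl,
        Real.sign_of_pos ht, abs_of_pos ht, Real.rpow_one, ← Complex.exp_add, ← Complex.exp_add]
      congr 1
      have hpi' : (Real.pi : ℂ) ≠ 0 := by exact_mod_cast hpi.ne'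
      simp only [s]
      push_cast
      field_simp
      ring_nf
      simp only [Complex.I_sq]
      ring
  · have hpos := neg_mul_cos_pos h0 h2 h1
    have hγ : 0 < Real.Gamma (2 - α) := Real.Gamma_pos_of_pos (by linarith)
    have hcos : Real.cos (Real.pi * α / 2) ≠ 0 := by
      intro h; rw [h] at hpos; simp at hpos
    have hα1 : α - 1 ≠ 0 := sub_ne_zero.2 h1
    -- Solves the real-part equation `s * Γ(2 - α) * cos (π α / 2) = -c * α * (α - 1)`, written so
    -- that positivity is visible.
    set s := c * (α * (α - 1)) ^ 2 / (Real.Gamma (2 - α) *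
      -(α * (α - 1) * Real.cos (Real.pi * α / 2))) with hsdef
    have hs : 0 < s := by positivity
    have hs' : s * Real.Gamma (2 - α) * Real.cos (Real.pi * α / 2) = -(c * (α * (α - 1))) := by
      rw [hsdef]
      generalize Real.cos (Real.pi * α / 2) = C at hcos
      field_simp
    -- In this parametrization `β` enters the two intensities with the sign opposite to the case `α
    -- = 1`.
    refine ⟨s * (1 - β) / 2, s * (1 + β) / 2, a + Real.Gamma (2 - α) * s * β / (α - 1), ?_, ?_,
      fun t ht ↦ ?_⟩
    · have : 0 < 1 - β := by linarith
      positivity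
    · have : 0 < 1 + β := by linarith
      positivity
    · have e : -((t : ℂ) * Complex.I) = ((-t : ℝ) : ℂ) * Complex.I := by push_cast; ring
      rw [e, levyExponent_mul_I_of_ne_one h0 h2 h1 ht.ne',
        levyExponent_mul_I_of_ne_one h0 h2 h1 (neg_ne_zero.2 ht.ne'),
        cpow_ofReal_mul_I ht, cpow_ofReal_mul_neg_I ht, stableCharFun, stableOmega, if_neg h1,
        Real.sign_of_pos ht, abs_of_pos ht, Real.tan_eq_sin_div_cos, ← Complex.exp_add,
        ← Complex.exp_add]
      congr 1
      set C := Real.cos (Real.pi * α / 2)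
      set S := Real.sin (Real.pi * α / 2)
      set γ := Real.Gamma (2 - α)
      set T := t ^ α
      have hC' : (C : ℂ) ≠ 0 := by exact_mod_cast hcos
      have hα' : (α : ℂ) ≠ 0 := by exact_mod_cast h0.ne'
      have hα1' : (α : ℂ) - 1 ≠ 0 := by exact_mod_cast hα1
      have hs2 : (c : ℂ) = -(s * γ * C) / (α * (α - 1)) := by
        have : (s : ℂ) * γ * C = -(c * (α * (α - 1))) := by exact_mod_cast hs'
        rw [this]; field_simp
      push_cast
      rw [hs2]
      field_simp
      ring

end Exponent

/-! ### Non-extremal stable laws as weighted reference laws. -/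

theorem ext_of_charFun_pos {μ ν : Measure ℝ} [IsProbabilityMeasure μ] [IsProbabilityMeasure ν]
    (h : ∀ t : ℝ, 0 < t → charFun μ t = charFun ν t) : μ = ν := by
  refine Measure.ext_of_charFun (funext fun t ↦ ?_)
  rcases lt_trichotomy t 0 with ht | rfl | ht
  · have := h (-t) (by linarith)
    rw [charFun_neg, charFun_neg] at this
    exact (starRingEnd ℂ).injective this
  · simp
  · exact h t ht

/-- The frequency dependence of the stable exponent is Hölder at the origin. -/
theorem exists_rpow_mul_one_add_abs_stableOmega_le {α : ℝ} (h0 : 0 < α) :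
    ∃ C η : ℝ, 0 ≤ C ∧ 0 < η ∧ η ≤ 1 ∧
      ∀ t : ℝ, t ≠ 0 → |t| ≤ 1 → |t| ^ α * (1 + |stableOmega α t|) ≤ C * |t| ^ η := by
  by_cases h1 : α = 1
  · subst h1
    -- From `|log |t|| * |t| ^ (1 / 2) ≤ 2` on `|t| ≤ 1`, plus `1` for the term without logarithm.
    refine ⟨3, 1 / 2, by norm_num, by norm_num, by norm_num, fun t ht ht1 ↦ ?_⟩
    have hpos : 0 < |t| := abs_pos.2 ht
    have hlog := (Real.abs_log_mul_self_rpow_lt |t| (1 / 2) hpos ht1 (by norm_num)).le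
    rw [abs_mul, abs_of_nonneg (Real.rpow_nonneg (abs_nonneg t) _)] at hlog
    have hsplit : |t| ^ (1 : ℝ) = |t| ^ (1 / 2 : ℝ) * |t| ^ (1 / 2 : ℝ) := by
      rw [← Real.rpow_add hpos]; norm_num
    have hle : |t| ^ (1 / 2 : ℝ) ≤ 1 := Real.rpow_le_one (abs_nonneg t) ht1 (by norm_num)
    have hn : 0 ≤ |t| ^ (1 / 2 : ℝ) := by positivity
    have hω : |stableOmega 1 t| ≤ |Real.log (|t|)| := by
      rw [stableOmega, if_pos rfl, abs_mul]
      refine mul_le_of_le_one_left (abs_nonneg _) ?_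
      rw [abs_of_pos (by positivity), div_le_one Real.pi_pos]
      linarith [Real.pi_gt_three]
    rw [hsplit, mul_assoc, mul_comm 3]
    refine mul_le_mul_of_nonneg_left ?_ hn
    nlinarith [mul_le_mul_of_nonneg_left hω hn]
  · set T := |Real.tan (Real.pi * α / 2)|
    refine ⟨1 + T, min α 1, by positivity, by positivity, min_le_right _ _, fun t ht ht1 ↦ ?_⟩
    rw [stableOmega, if_neg h1, mul_comm]
    refine mul_le_mul_of_nonneg_left ?_ (by positivity)
    exact Real.rpow_le_rpow_of_exponent_ge (abs_pos.2 ht) ht1 (min_le_left _ _)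

namespace IsStableLawWith

variable {α β a c : ℝ} {ν : Measure ℝ}

theorem norm_charFun (h : IsStableLawWith α β a c ν) (t : ℝ) :
    ‖charFun ν t‖ = Real.exp (-(c * |t| ^ α)) := by
  rw [h.charFun_eq, stableCharFun, Complex.norm_exp]
  congr 1
  rw [Complex.sub_re, Complex.I_mul_re, Complex.ofReal_im, Complex.re_ofReal_mul, Complex.add_re,
    Complex.I_mul_re, Complex.ofReal_im]
  simp

theorem integrable_charFun (h : IsStableLawWith α β a c ν) : Integrable (charFun ν) := by
  have := h.isProbabilityMeasure
  have hr : Integrable (fun t : ℝ ↦ Real.exp (-(c * ‖t‖ ^ α))) := by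
    rw [integrable_fun_norm_addHaar volume (f := fun y ↦ Real.exp (-(c * y ^ α)))]
    refine (integrableOn_rpow_mul_exp_neg_mul_rpow (s := 0) (by norm_num) h.alpha_pos
      h.scale_pos).congr_fun (fun x _ ↦ ?_) measurableSet_Ioi
    simp
  refine hr.mono' measurable_charFun.aestronglyMeasurable (ae_of_all _ fun t ↦ ?_)
  rw [h.norm_charFun, Real.norm_eq_abs]

/-- The exponent `-w` has `Re w ≥ 0`, so `‖1 - exp (-w)‖ ≤ ‖w‖`, and `w` is Hölder at the origin. -/
theorem exists_norm_one_sub_charFun_le (h : IsStableLawWith α β a c ν) :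
    ∃ C η : ℝ, 0 ≤ C ∧ 0 < η ∧ η ≤ 1 ∧ ∀ t, |t| ≤ 1 → ‖1 - charFun ν t‖ ≤ C * |t| ^ η := by
  have := h.isProbabilityMeasure
  obtain ⟨C, η, hC, hη, hη1, hCη⟩ := exists_rpow_mul_one_add_abs_stableOmega_le h.alpha_pos
  have hc := h.scale_pos
  refine ⟨|a| + c * C, η, by positivity, hη, hη1, fun t ht1 ↦ ?_⟩
  rcases eq_or_ne t 0 with rfl | ht
  · simp [hη.ne']
  set q : ℂ := 1 + Complex.I * (β * Real.sign t * stableOmega α t : ℝ) with hq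
  set w : ℂ := (c * |t| ^ α : ℝ) * q - Complex.I * (a * t : ℝ) with hw
  have hf : charFun ν t = Complex.exp (-w) := by
    rw [h.charFun_eq, stableCharFun, hw]
    congr 1
    ring
  have hqre : q.re = 1 := by
    rw [hq, Complex.add_re, Complex.I_mul_re, Complex.ofReal_im]; simp
  have hwre : 0 ≤ w.re := by
    rw [hw, Complex.sub_re, Complex.I_mul_re, Complex.ofReal_im, Complex.re_ofReal_mul, hqre]
    simp only [mul_one, neg_zero, sub_zero]
    positivity
  have h1 := norm_exp_neg_sub_exp_neg_le hwre (w' := 0) le_rfl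
  rw [neg_zero, Complex.exp_zero, sub_zero, ← hf, norm_sub_rev] at h1
  refine h1.trans ((norm_sub_le _ _).trans ?_)
  have hβ : |β| ≤ 1 := abs_le.2 ⟨h.neg_one_le_beta, h.beta_le_one⟩
  have hsign : |Real.sign t| ≤ 1 := by
    rcases Real.sign_apply_eq t with h | h | h <;> rw [h] <;> norm_num
  have hqn : ‖q‖ ≤ 1 + |stableOmega α t| := by
    refine (norm_add_le _ _).trans ?_
    rw [norm_one, norm_mul, Complex.norm_I, one_mul, Complex.norm_real, Real.norm_eq_abs, abs_mul,
      abs_mul]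
    gcongr
    refine mul_le_of_le_one_left (abs_nonneg _) ?_
    exact mul_le_one₀ hβ (abs_nonneg _) hsign
  rw [norm_mul, norm_mul, Complex.norm_I, one_mul, Complex.norm_real, Complex.norm_real,
    Real.norm_of_nonneg (by positivity), Real.norm_eq_abs, abs_mul]
  have ht' : |t| ≤ |t| ^ η := by
    nth_rw 1 [← Real.rpow_one |t|]
    exact Real.rpow_le_rpow_of_exponent_ge (abs_pos.2 ht) ht1 hη1
  calc c * |t| ^ α * ‖q‖ + |a| * |t|
      ≤ c * |t| ^ α * (1 + |stableOmega α t|) + |a| * |t| ^ η := by gcongr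
    _ = c * (|t| ^ α * (1 + |stableOmega α t|)) + |a| * |t| ^ η := by ring
    _ ≤ c * (C * |t| ^ η) + |a| * |t| ^ η := by
        have := mul_le_mul_of_nonneg_left (hCη t ht ht1) hc.le
        gcongr
    _ = _ := by ring

/-- A non-extremal stable law contains a multiple of the difference of two independent large jumps
as a convolution factor. -/
theorem exists_smul_conv_le (h : IsStableLawWith α β a c ν) (hβ : -1 < β) (hβ' : β < 1) :
    ∃ c₁ c₂ κ : ℝ, 0 < c₁ ∧ 0 < c₂ ∧ 0 < κ ∧ ∃ ρ : Measure ℝ, IsProbabilityMeasure ρ ∧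
      ENNReal.ofReal κ • (((powerLevyMeasure α c₁ (Set.Ioi 1)).conv
        ((powerLevyMeasure α c₂ (Set.Ioi 1)).map fun x ↦ -x)).conv ρ) ≤ ν := by
  have := h.isProbabilityMeasure
  have h0 := h.alpha_pos
  have h2 := h.alpha_lt_two
  obtain ⟨c₁, c₂, a', hc₁, hc₂, hchar⟩ := exists_stableCharFun_eq_mul (a := a) h0 h2 hβ hβ' h.scale_pos
  obtain ⟨U₁, ρ₁, _, _, hU₁, κ₁, hκ₁, hle₁⟩ := exists_oneSided_stable h0 h2 hc₁
  obtain ⟨U₂, ρ₂, _, _, hU₂, κ₂, hκ₂, hle₂⟩ := exists_oneSided_stable h0 h2 hc₂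
  set L₁ := powerLevyMeasure α c₁ (Set.Ioi 1)
  set L₂ := powerLevyMeasure α c₂ (Set.Ioi 1)
  have : IsFiniteMeasure L₁ := isFiniteMeasure_powerLevyMeasure c₁ h0 zero_lt_one subset_rfl
  have : IsFiniteMeasure L₂ := isFiniteMeasure_powerLevyMeasure c₂ h0 zero_lt_one subset_rfl
  have hmapP (μ : Measure ℝ) [IsProbabilityMeasure μ] : IsProbabilityMeasure (μ.map fun x ↦ -x) :=
    Measure.isProbabilityMeasure_map (by fun_prop)
  have := hmapP U₂
  have := hmapP ρ₂
  -- The stable law is that of a difference of independent one-sided stable variables, shifted by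
  -- `a'`.
  have hν : ν = (U₁.conv (U₂.map fun x ↦ -x)).conv (Measure.dirac a') := by
    refine ext_of_charFun_pos fun t ht ↦ ?_
    have hneg : charFun (U₂.map fun x ↦ -x) t = charFun U₂ (-t) := by
      have := charFun_map_mul (μ := U₂) (-1) t
      simpa using this
    rw [h.charFun_eq, hchar t ht, charFun_conv, charFun_conv, hneg, hU₁, hU₂, charFun_dirac]
    congr 3
    · push_cast; ring_nf
    · simp only [RCLike.inner_apply, conj_trivial]
      push_cast; ring
  have hle₂' : ((ENNReal.ofReal κ₂ • L₂).map fun x ↦ -x).conv (ρ₂.map fun x ↦ -x) ≤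
      U₂.map fun x ↦ -x := by
    have := Measure.map_mono hle₂ (f := fun x ↦ -x) (by fun_prop)
    refine le_of_eq_of_le ?_ this
    exact (Measure.map_conv_continuousLinearMap (μ := ENNReal.ofReal κ₂ • L₂) (ν := ρ₂)
      (-ContinuousLinearMap.id ℝ ℝ)).symm
  refine ⟨c₁, c₂, κ₁ * κ₂, hc₁, hc₂, by positivity,
    (ρ₁.conv (ρ₂.map fun x ↦ -x)).conv (Measure.dirac a'), inferInstance, ?_⟩
  have hle := conv_mono (conv_mono hle₁ hle₂') (le_refl (Measure.dirac a'))
  rw [← hν] at hle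
  refine le_of_eq_of_le ?_ hle
  set N₂ := L₂.map fun x ↦ -x
  have hN : (ENNReal.ofReal κ₂ • L₂).map (fun x ↦ -x) = ENNReal.ofReal κ₂ • N₂ := by
    rw [Measure.map_smul]
  set r₂ := ρ₂.map fun x ↦ -x
  -- The two jump parts are brought together; everything else is collected into one probability
  -- measure.
  have e : (L₁.conv ρ₁).conv (N₂.conv r₂) = (L₁.conv N₂).conv (ρ₁.conv r₂) := by
    rw [Measure.conv_assoc, Measure.conv_assoc, ← Measure.conv_assoc ρ₁, Measure.conv_comm ρ₁,
      Measure.conv_assoc N₂]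
  rw [hN, Measure.conv_smul_left, Measure.conv_smul_left, Measure.conv_smul_left,
    Measure.conv_comm (L₁.conv ρ₁), Measure.conv_smul_left, Measure.conv_smul_left,
    Measure.conv_comm (N₂.conv r₂), e, Measure.conv_smul_left, smul_smul,
    ENNReal.ofReal_mul hκ₁.le, ← Measure.conv_assoc (L₁.conv N₂)]

theorem isWeightedReference (h : IsStableLawWith α β a c ν) (hβ : -1 < β) (hβ' : β < 1) :
    IsWeightedReference (fun x ↦ Real.log (1 + |x|)) ν := by
  have := h.isProbabilityMeasure
  have h0 := h.alpha_pos
  refine ⟨⟨_, ENNReal.ofReal_ne_top, le_smul_volume_of_integrable_charFun h.integrable_charFun⟩,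
    ?_, ?_⟩
  · obtain ⟨c₁, c₂, κ, hc₁, hc₂, hκ, ρ, hρ, hle⟩ := h.exists_smul_conv_le hβ hβ'
    obtain ⟨C, hC, hJ⟩ := withDensity_le_conv_powerLevyMeasure h0 hc₁ hc₂
    set B := 2 * (1 + α)
    have hB : 0 ≤ B := by positivity
    set w : ℝ → ℝ≥0∞ := fun x ↦ ENNReal.ofReal (C * Real.exp (-(B * Real.log (1 + |x|)))) with hw
    set u : ℝ → ℝ≥0∞ := fun x ↦ ENNReal.ofReal (Real.exp (-(B * Real.log (1 + |x|)))) with hu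
    have hwm : Measurable w := by fun_prop
    have hum : Measurable u := by fun_prop
    -- Submultiplicativity of `1 + |x|`: a shift by `y` changes the polynomial bound by a factor of
    -- at least `(1 + |y|) ^ (-B)`.
    have huw (x y : ℝ) : u y * w x ≤ w (x - y) := by
      rw [hu, hw, ← ENNReal.ofReal_mul (Real.exp_nonneg _)]
      refine ENNReal.ofReal_le_ofReal ?_
      rw [mul_left_comm, ← Real.exp_add]
      gcongr
      have h1 : Real.log (1 + |x - y|) ≤ Real.log ((1 + |x|) * (1 + |y|)) := by
        refine Real.log_le_log (by positivity) ?_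
        nlinarith [abs_sub x y, mul_nonneg (abs_nonneg x) (abs_nonneg y)]
      rw [Real.log_mul (by positivity) (by positivity)] at h1
      nlinarith
    have hconv := withDensity_le_conv hwm hum huw ρ
    set m := ∫⁻ y, u y ∂ρ
    -- No moment of `ρ` is needed: `u` is strictly positive everywhere, so its integral against a
    -- probability measure cannot vanish.
    have hm0 : m ≠ 0 := by
      intro hm
      rw [lintegral_eq_zero_iff hum] at hm
      obtain ⟨y, hy⟩ := hm.exists
      simp only [hu, Pi.zero_apply, ENNReal.ofReal_eq_zero] at hy
      exact absurd hy (not_le.2 (Real.exp_pos _))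
    have hm1 : m ≠ ∞ := by
      refine ne_top_of_le_ne_top ENNReal.one_ne_top ?_
      calc m ≤ ∫⁻ _, 1 ∂ρ := by
            refine lintegral_mono fun y ↦ ?_
            rw [hu, ← ENNReal.ofReal_one]
            refine ENNReal.ofReal_le_ofReal (Real.exp_le_one_iff.2 ?_)
            have := isModerateWeight_log_one_add_abs.nonneg y
            have : 0 ≤ B * Real.log (1 + |y|) := mul_nonneg hB this
            linarith
        _ = 1 := by simp
    have hmp := ENNReal.toReal_pos hm0 hm1
    set D := κ * (m.toReal * C)
    have hD : 0 < D := by positivity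
    refine ⟨max (-Real.log D) 0, B, le_max_right _ _, hB, ?_⟩
    calc volume.withDensity (fun x ↦ ENNReal.ofReal
            (Real.exp (-(max (-Real.log D) 0 + B * Real.log (1 + |x|)))))
        ≤ volume.withDensity (fun x ↦ ENNReal.ofReal κ * (m * w x)) := by
          refine withDensity_mono (ae_of_all _ fun x ↦ ?_)
          simp only [hw]
          rw [← ENNReal.ofReal_toReal hm1, ← ENNReal.ofReal_mul hmp.le, ← ENNReal.ofReal_mul hκ.le]
          refine ENNReal.ofReal_le_ofReal ?_
          calc _ ≤ Real.exp (Real.log D + -(B * Real.log (1 + |x|))) := by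
                rw [Real.exp_le_exp]
                linarith [le_max_left (-Real.log D) 0]
            _ = _ := by
                rw [Real.exp_add, Real.exp_log hD]; ring
      _ = ENNReal.ofReal κ • m • volume.withDensity w := by
          rw [← withDensity_smul _ hwm, ← withDensity_smul _ (hwm.const_smul _)]
          rfl
      _ ≤ ENNReal.ofReal κ • (((powerLevyMeasure α c₁ (Set.Ioi 1)).conv
            ((powerLevyMeasure α c₂ (Set.Ioi 1)).map fun x ↦ -x)).conv ρ) := by
          gcongr
          exact hconv.trans (conv_mono hJ le_rfl)
      _ ≤ ν := hle
  · obtain ⟨C, η, hC, hη, hη1, hCη⟩ := h.exists_norm_one_sub_charFun_le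
    exact exists_lintegral_exp_log_ne_top_of_charFun hC hη hη1 hCη

end IsStableLawWith

theorem corollary2p6 {Ω Ω' : Type*} [MeasurableSpace Ω] [MeasurableSpace Ω']
    (P : Measure Ω) [IsProbabilityMeasure P] (P' : Measure Ω') [IsProbabilityMeasure P']
    (X : ℕ → Ω → ℝ) (hX : ∀ i, Measurable (X i))
    (hindep : iIndepFun X P) (hident : ∀ i, IdentDistrib (X i) (X 0) P P)
    (a b : ℕ → ℝ) (hb : ∀ n, 1 ≤ n → 0 < b n)
    (Z : Ω' → ℝ) (hZ : Measurable Z) (hstable : IsNonExtremalStable (P'.map Z))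
    (n₀ : ℕ) (hn₀ : 1 ≤ n₀)
    (hfin : relEntropy P (normalizedSum X a b n₀) P' Z < ∞) :
    ∀ n, n₀ ≤ n → relEntropy P (normalizedSum X a b n) P' Z < ∞ := by
  intro n hn
  rcases hstable with ⟨m, v, hv, hν⟩ | ⟨α, β, a₀, c, hν, hβ, hβ'⟩
  · exact relEntropy_normalizedSum_lt_top P P' X hX hindep hident a b hb Z hZ isModerateWeight_sq
      (hν ▸ isWeightedReference_gaussianReal m hv) n₀ hn₀ hfin n hn
  · exact relEntropy_normalizedSum_lt_top P P' X hX hindep hident a b hb Z hZ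
      isModerateWeight_log_one_add_abs (hν.isWeightedReference hβ hβ') n₀ hn₀ hfin n hn
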